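/- **Base.** Let $\mathcal S$ be a category with finite products (final object $*$) and an initial object $\emptyset$, endowed with two classes of morphisms, the *smooth morphisms* and the *closed immersions*, each closed under composition and containing all isomorphisms, such that: - pullbacks along smooth morphisms exist, and smooth morphisms are stable under base change; closed immersions are stable under base change along smooth morphisms; if $g\circ z$ is a closed immersion then so is $z$; - every morphism factors as a closed immersion followed by a smooth morphism; - every closed immersion $z:Z\to X$ has a complementary open immersion, i.e. a smooth monomorphism $w:W\to X$ such that $f:T\to X$ factors through $w$ if and only if $\emptyset=T\times_XZ$ (the square with vertices $\emptyset,T,Z,X$ is Cartesian); - every $X$ has a finite filtration $\emptyset=Z_{-1}\to Z_0\to\dots\to Z_n=X$ by closed immersions such that the open complement of each $Z_{r-1}\to Z_{r}$ is smooth over $*$. Let $\mathcal U\subset\mathcal S$ be the full subcategory of the objects smooth over $*$. **Fibered categories.** A (triangulated) $\mathcal S$-fibered category $\mathbb H$ consists of (triangulated) categories $\mathbb H(X)$, (triangulated) inverse image functors $f^*$ with $\mathrm{id}^*=\mathrm{id}$, and connection isomorphisms $(gf)^*\cong f^*g^*$ (compatible with shifts) satisfying the usual cocycle condition. A triangulated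 $\mathbb H$ is *localic* if $\mathbb H(\emptyset)=0$; $p^*$ has a left adjoint $p_\#$ for every smooth $p$, and the exchange map $p'_\#f'^*\to f^*p_\#$ is invertible for every Cartesian square with $p$ smooth; $z^*$ has a fully faithful right adjoint $z_*$ for every closed immersion $z$; and $(z^*,w^*)$ is conservative for every closed immersion $z$ with complementary open immersion $w$. A section of $\mathbb H$ is a family $A_X\in\mathbb H(X)$ with isomorphisms $f^*A_X\cong A_T$ compatible with composition; an isomorphism of sections is a compatible family of isomorphisms. A (triangulated) morphism $R:\mathbb H_1\to\mathbb H_2$ consists of (triangulated) functors $R_X$ with isomorphisms $\theta_f:f^*R_X\cong R_Tf^*$ (compatible with shifts) compatible with the connection isomorphisms; a triangulated $R$ is *localic* if $p_\#R_P\to R_Xp_\#$ is invertible for every smooth $p:P\to X$. **Tensor structures.** A (triangulated) internal tensor structure $(\otimes,m)$ on $\mathbb H$ consists of (bi-triangulated) bifunctors $\otimes$ on the $\mathbb H(X)$ and natural isomorphisms $m_f:f^*A\otimes f^*B\cong f^*(A\otimes B)$ (compatible with shifts), compatible with connection isomorphisms; it is *localic* if it is triangulated and the projection maps $p_\#(A\otimes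 p^*B)\to p_\#A\otimes B$ and $p_\#(p^*A\otimes B)\to A\otimes p_\#B$ are invertible for every smooth $p$. Internal associativity constraints $a$ (satisfying the pentagon), commutativity constraints $c$ (with $c\circ c=\mathrm{id}$), and unit constraints $u=(u_r,u_l)$ with a unit section $\mathbf 1$ ($u_r:A\otimes\mathbf 1_X\cong A$, $u_l:\mathbf 1_X\otimes B\cong B$, agreeing on $\mathbf 1_X\otimes\mathbf 1_X$) are the natural isomorphisms on the fibers satisfying these conditions and commuting with all inverse images via $m$ (and via the structure of the section $\mathbf 1$). Given $R:\mathbb H_1\to\mathbb H_2$ and internal tensor structures $(\otimes_i,m_i)$ on $\mathbb H_i$, a (triangulated) internal tensor structure $\rho$ on $R$ consists of natural isomorphisms $\rho_X:R_X(A)\otimes_2R_X(B)\cong R_X(A\otimes_1B)$ (compatible with shifts in each variable) commuting with inverse images via $m_1,m_2,\theta$. It is *associative* with respect to $a_1,a_2$ if the two composites $(R_XA\otimes_2 R_XB)\otimes_2 R_XC\to R_X(A\otimes_1(B\otimes_1C))$ built from $\rho$ and the $a_i$ coincide; *symmetric* with respect to $c_1,c_2$ if $R_X(c_1)\circ\rho_{A,B}=\rho_{B,A}\circ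 c_2$; and *unitary via* an isomorphism of sections $w:R(\mathbf 1^{(1)})\cong\mathbf 1^{(2)}$ with respect to $u_1,u_2$ if $u_{2,r}\circ(\mathrm{id}\otimes w_X)=R_X(u_{1,r})\circ\rho$ on $R_X(A)\otimes_2R_X(\mathbf 1^{(1)}_X)$ and $u_{2,l}\circ(w_X\otimes\mathrm{id})=R_X(u_{1,l})\circ\rho$ on $R_X(\mathbf 1^{(1)}_X)\otimes_2R_X(B)$. **Statement.** Let $\mathbb H_1,\mathbb H_2$ be localic $\mathcal S$-fibered categories with localic internal tensor structures $(\otimes_1,m_1)$, $(\otimes_2,m_2)$, let $R:\mathbb H_1\to\mathbb H_2$ be a localic morphism, and let $\rho$ be a triangulated internal tensor structure on the restriction of $R$ to $\mathcal U$ (with respect to the restrictions of the $(\otimes_i,m_i)$). Then $\rho$ extends uniquely to a triangulated internal tensor structure $\tilde\rho$ on $R$ over $\mathcal S$, and: 1. Let $a_1,a_2$ be internal associativity constraints on the restrictions of $(\otimes_1,m_1)$, $(\otimes_2,m_2)$ to $\mathcal U$. They extend uniquely to internal associativity constraints $\tilde a_1,\tilde a_2$ over $\mathcal S$, and if $\rho$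 is associative with respect to $a_1,a_2$, then $\tilde\rho$ is associative with respect to $\tilde a_1,\tilde a_2$. 2. Let $c_1,c_2$ be internal commutativity constraints on the restrictions of $(\otimes_1,m_1)$, $(\otimes_2,m_2)$ to $\mathcal U$. They extend uniquely to internal commutativity constraints $\tilde c_1,\tilde c_2$ over $\mathcal S$, and if $\rho$ is symmetric with respect to $c_1,c_2$, then $\tilde\rho$ is symmetric with respect to $\tilde c_1,\tilde c_2$. 3. Every section of $\mathbb H_i$ over $\mathcal U$ is the restriction of a section over $\mathcal S$, and every isomorphism between the restrictions to $\mathcal U$ of two sections over $\mathcal S$ extends uniquely to an isomorphism over $\mathcal S$. Let $u_1,u_2$ be internal unit constraints on the restrictions of $(\otimes_1,m_1)$, $(\otimes_2,m_2)$ to $\mathcal U$, with unit sections $\mathbf 1^{(1)},\mathbf 1^{(2)}$ over $\mathcal U$, let $w:R(\mathbf 1^{(1)})\cong\mathbf 1^{(2)}$ be an isomorphism of sections over $\mathcal U$, and let $\tilde{\mathbf 1}^{(1)},\tilde{\mathbf 1}^{(2)}$ be sections over $\mathcal S$ extending $\mathbf 1^{(1)},\mathbf 1^{(2)}$. Then $u_i$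 extends uniquely to an internal unit constraint $\tilde u_i$ over $\mathcal S$ with unit section $\tilde{\mathbf 1}^{(i)}$, $w$ extends uniquely to an isomorphism $\tilde w:R(\tilde{\mathbf 1}^{(1)})\cong\tilde{\mathbf 1}^{(2)}$, and if $\rho$ is unitary via $w$ with respect to $u_1,u_2$, then $\tilde\rho$ is unitary via $\tilde w$ with respect to $\tilde u_1,\tilde u_2$. -/

import Mathlib

open CategoryTheory CategoryTheory.Limits

universe v' u' v'' u'' v u

namespace FibExt

/-! ### The base category -/

section Base

variable {𝒮 : Type u} [Category.{v} 𝒮]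

/-- `w : W ⟶ X` is the open immersion complementary to `z : Z ⟶ X`: it is smooth, and composition
with `w` identifies `Hom(T, W)` with the set of those `f : T ⟶ X` for which the square with
vertices `∅`, `T`, `Z`, `X` is Cartesian. -/
structure IsOpenComplement [HasInitial 𝒮] (sm : MorphismProperty 𝒮) {Z W X : 𝒮}
    (z : Z ⟶ X) (w : W ⟶ X) : Prop where
  smooth : sm w
  injective : ∀ T : 𝒮, Function.Injective (fun a : T ⟶ W => a ≫ w)
  range : ∀ (T : 𝒮) (f : T ⟶ X),
    (∃ a : T ⟶ W, a ≫ w = f) ↔ IsPullback (initial.to T) (initial.to Z) f z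

variable (𝒮) in
/-- Classes of smooth morphisms and of closed immersions on a category with finite products and
an initial object, subject to the axioms modelled on quasi-projective varieties. -/
structure Geometry [HasFiniteProducts 𝒮] [HasInitial 𝒮] where
  /-- smooth morphisms -/
  sm : MorphismProperty 𝒮
  /-- closed immersions -/
  cl : MorphismProperty 𝒮
  sm_multiplicative : sm.IsMultiplicative
  cl_multiplicative : cl.IsMultiplicative
  sm_of_iso : MorphismProperty.isomorphisms 𝒮 ≤ sm
  cl_of_iso : MorphismProperty.isomorphisms 𝒮 ≤ cl
  sm_hasPullback : ∀ {P T X : 𝒮} (p : P ⟶ X) (f : T ⟶ X), sm p → HasPullback p f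
  sm_baseChange : ∀ {P' P T X : 𝒮} {f' : P' ⟶ P} {p' : P' ⟶ T} {p : P ⟶ X} {f : T ⟶ X},
    IsPullback f' p' p f → sm p → sm p'
  cl_baseChange : ∀ {P' P Z X : 𝒮} {z' : P' ⟶ P} {p' : P' ⟶ Z} {p : P ⟶ X} {z : Z ⟶ X},
    IsPullback z' p' p z → sm p → cl z → cl z'
  cl_cancel : ∀ {Z X V : 𝒮} (z : Z ⟶ X) (g : X ⟶ V), cl (z ≫ g) → cl z
  factorization : ∀ {T X : 𝒮} (f : T ⟶ X),
    ∃ (P : 𝒮) (t : T ⟶ P) (p : P ⟶ X), cl t ∧ sm p ∧ t ≫ p = f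
  exists_complement : ∀ {Z X : 𝒮} (z : Z ⟶ X), cl z →
    ∃ (W : 𝒮) (w : W ⟶ X), IsOpenComplement sm z w
  /-- Every object `X` has a finite filtration `∅ = Z₋₁ ⟶ Z₀ ⟶ ⋯ ⟶ Zₙ = X` by closed immersions
  whose successive open complements are smooth over the final object. (The objects `Z₋₁, …, Zₙ`
  are numbered from `0` to `n + 1`.) -/
  stratification : ∀ X : 𝒮, ∃ (n : ℕ) (Z : ComposableArrows 𝒮 (n + 1)),
    Nonempty (IsInitial (Z.obj' 0)) ∧ Z.obj' (n + 1) = X ∧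
    ∀ (r : ℕ) (hr : r < n + 1),
      cl (Z.map' r (r + 1) (by omega) (by omega)) ∧
      ∃ (W : 𝒮) (w : W ⟶ Z.obj' (r + 1)),
        IsOpenComplement sm (Z.map' r (r + 1) (by omega) (by omega)) w ∧ sm (terminal.from W)

/-- The class of objects of the full subcategory `𝒰`: those whose morphism to the final object is
smooth. -/
def Geometry.U [HasFiniteProducts 𝒮] [HasInitial 𝒮] (G : Geometry 𝒮) : ObjectProperty 𝒮 :=
  fun Y => G.sm (terminal.from Y)

end Base

/-! ### Fibered categories, sections, morphisms -/

/-- An `𝒮`-fibered category. The connection isomorphism `(g f)^* ≅ f^* g^*` is indexed by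
composable `f`, `g` together with a name `h` for their composite. -/
structure FiberedCat (𝒮 : Type u) [Category.{v} 𝒮] where
  Fib : 𝒮 → Type u'
  [cat : ∀ X, Category.{v'} (Fib X)]
  /-- the inverse image functor `f^*` -/
  pull : ∀ {T X : 𝒮}, (T ⟶ X) → (Fib X ⥤ Fib T)
  conn : ∀ {T X V : 𝒮} (f : T ⟶ X) (g : X ⟶ V) (h : T ⟶ V), f ≫ g = h →
    (pull h ≅ pull g ⋙ pull f)
  pull_id : ∀ X : 𝒮, pull (𝟙 X) = 𝟭 (Fib X)
  conn_assoc : ∀ {T X V W : 𝒮} (f : T ⟶ X) (g : X ⟶ V) (h : V ⟶ W)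
    (fg : T ⟶ V) (gh : X ⟶ W) (k : T ⟶ W) (hfg : f ≫ g = fg) (hgh : g ≫ h = gh)
    (h₁ : f ≫ gh = k) (h₂ : fg ≫ h = k) (A : Fib W),
    (conn f gh k h₁).hom.app A ≫ (pull f).map ((conn g h gh hgh).hom.app A) =
      (conn fg h k h₂).hom.app A ≫ (conn f g fg hfg).hom.app ((pull h).obj A)

attribute [instance] FiberedCat.cat

section Defs

variable {𝒮 : Type u} [Category.{v} 𝒮]

/-- The underlying fibered category over a full subcategory. -/
def FiberedCat.restrict (H : FiberedCat.{v', u'} 𝒮) (P : ObjectProperty 𝒮) :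
    FiberedCat.{v', u'} P.FullSubcategory where
  Fib X := H.Fib X.obj
  cat X := H.cat X.obj
  pull f := H.pull f.hom
  conn f g h w := H.conn f.hom g.hom h.hom (by rw [← w]; rfl)
  pull_id X := H.pull_id X.obj
  conn_assoc f g h fg gh k hfg hgh h₁ h₂ A :=
    H.conn_assoc f.hom g.hom h.hom fg.hom gh.hom k.hom
      (by rw [← hfg]; rfl) (by rw [← hgh]; rfl) (by rw [← h₁]; rfl) (by rw [← h₂]; rfl) A

/-- A section of a fibered category. -/
@[ext]
structure Sect (H : FiberedCat.{v', u'} 𝒮) where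
  obj : ∀ X : 𝒮, H.Fib X
  /-- `A_f^* : f^* A_X ≅ A_T` -/
  iso : ∀ {T X : 𝒮} (f : T ⟶ X), (H.pull f).obj (obj X) ≅ obj T
  comp : ∀ {V T X : 𝒮} (f : V ⟶ T) (g : T ⟶ X),
    (H.pull f).map (iso g).hom ≫ (iso f).hom =
      (H.conn f g (f ≫ g) rfl).inv.app (obj X) ≫ (iso (f ≫ g)).hom

/-- Restriction of sections. -/
def Sect.restrict {H : FiberedCat.{v', u'} 𝒮} (A : Sect H) (P : ObjectProperty 𝒮) :
    Sect (H.restrict P) where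
  obj X := A.obj X.obj
  iso f := A.iso f.hom
  comp f g := A.comp f.hom g.hom

/-- An isomorphism between sections. -/
@[ext]
structure SectIso {H : FiberedCat.{v', u'} 𝒮} (A B : Sect H) where
  iso : ∀ X : 𝒮, A.obj X ≅ B.obj X
  comm : ∀ {T X : 𝒮} (f : T ⟶ X),
    (H.pull f).map (iso X).hom ≫ (B.iso f).hom = (A.iso f).hom ≫ (iso T).hom

/-- Restriction of isomorphisms of sections. -/
def SectIso.restrict {H : FiberedCat.{v', u'} 𝒮} {A B : Sect H} (w : SectIso A B)
    (P : ObjectProperty 𝒮) : SectIso (A.restrict P) (B.restrict P) where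
  iso X := w.iso X.obj
  comm f := w.comm f.hom

/-- A morphism of fibered categories: functors `R_X` with `𝒮`-structure `θ`. -/
structure Mor (H₁ : FiberedCat.{v', u'} 𝒮) (H₂ : FiberedCat.{v'', u''} 𝒮) where
  R : ∀ X : 𝒮, H₁.Fib X ⥤ H₂.Fib X
  /-- `θ_f : f^* R_X(A) ≅ R_T(f^* A)` -/
  θ : ∀ {T X : 𝒮} (f : T ⟶ X), R X ⋙ H₂.pull f ≅ H₁.pull f ⋙ R T
  comp : ∀ {T X V : 𝒮} (f : T ⟶ X) (g : X ⟶ V) (A : H₁.Fib V),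
    (θ (f ≫ g)).hom.app A ≫ (R T).map ((H₁.conn f g (f ≫ g) rfl).hom.app A) =
      (H₂.conn f g (f ≫ g) rfl).hom.app ((R V).obj A) ≫
        (H₂.pull f).map ((θ g).hom.app A) ≫ (θ f).hom.app ((H₁.pull g).obj A)

/-- Restriction of morphisms of fibered categories. -/
def Mor.restrict {H₁ : FiberedCat.{v', u'} 𝒮} {H₂ : FiberedCat.{v'', u''} 𝒮} (R : Mor H₁ H₂)
    (P : ObjectProperty 𝒮) : Mor (H₁.restrict P) (H₂.restrict P) where
  R X := R.R X.obj
  θ f := R.θ f.hom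
  comp f g A := R.comp f.hom g.hom A

/-- The image `R(A)` of a section `A`. -/
def Mor.sect {H₁ : FiberedCat.{v', u'} 𝒮} {H₂ : FiberedCat.{v'', u''} 𝒮} (R : Mor H₁ H₂)
    (A : Sect H₁) : Sect H₂ where
  obj X := (R.R X).obj (A.obj X)
  iso {T X} f := (R.θ f).app (A.obj X) ≪≫ (R.R T).mapIso (A.iso f)
  comp {V T X} f g := by
    have h₁ := R.comp f g (A.obj X)
    have h₂ := A.comp f g
    have h₃ := (R.θ f).hom.naturality (A.iso g).hom
    simp only [Functor.comp_map] at h₃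
    rw [← cancel_epi ((H₂.conn f g (f ≫ g) rfl).hom.app ((R.R X).obj (A.obj X)))]
    simp only [Iso.trans_hom, Iso.app_hom, Functor.mapIso_hom, Functor.map_comp, Category.assoc,
      Iso.hom_inv_id_app_assoc]
    rw [reassoc_of% h₃, ← Functor.map_comp, h₂, Functor.map_comp, ← reassoc_of% h₁,
      ← Functor.map_comp_assoc, Iso.hom_inv_id_app,
      CategoryTheory.Functor.map_id, Category.id_comp]

/-! ### Tensor structures and constraints -/

/-- An internal tensor structure `(⊗, m)` on a fibered category. -/
structure TensorStr (H : FiberedCat.{v', u'} 𝒮) where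
  tensor : ∀ X : 𝒮, H.Fib X ⥤ H.Fib X ⥤ H.Fib X
  /-- `m_f : f^* A ⊗ f^* B ≅ f^* (A ⊗ B)` -/
  m : ∀ {T X : 𝒮} (f : T ⟶ X) (A B : H.Fib X),
    ((tensor T).obj ((H.pull f).obj A)).obj ((H.pull f).obj B) ≅
      (H.pull f).obj (((tensor X).obj A).obj B)
  m_natural_left : ∀ {T X : 𝒮} (f : T ⟶ X) {A A' : H.Fib X} (a : A ⟶ A') (B : H.Fib X),
    ((tensor T).map ((H.pull f).map a)).app ((H.pull f).obj B) ≫ (m f A' B).hom =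
      (m f A B).hom ≫ (H.pull f).map (((tensor X).map a).app B)
  m_natural_right : ∀ {T X : 𝒮} (f : T ⟶ X) (A : H.Fib X) {B B' : H.Fib X} (b : B ⟶ B'),
    ((tensor T).obj ((H.pull f).obj A)).map ((H.pull f).map b) ≫ (m f A B').hom =
      (m f A B).hom ≫ (H.pull f).map (((tensor X).obj A).map b)
  m_comp : ∀ {T X V : 𝒮} (f : T ⟶ X) (g : X ⟶ V) (A B : H.Fib V),
    (m (f ≫ g) A B).hom ≫ (H.conn f g (f ≫ g) rfl).hom.app (((tensor V).obj A).obj B) =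
      ((tensor T).map ((H.conn f g (f ≫ g) rfl).hom.app A)).app ((H.pull (f ≫ g)).obj B) ≫
      ((tensor T).obj ((H.pull f).obj ((H.pull g).obj A))).map
        ((H.conn f g (f ≫ g) rfl).hom.app B) ≫
      (m f ((H.pull g).obj A) ((H.pull g).obj B)).hom ≫ (H.pull f).map (m g A B).hom

/-- Restriction of internal tensor structures. -/
def TensorStr.restrict {H : FiberedCat.{v', u'} 𝒮} (t : TensorStr H) (P : ObjectProperty 𝒮) :
    TensorStr (H.restrict P) where
  tensor X := t.tensor X.obj
  m f A B := t.m f.hom A B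
  m_natural_left f _ _ a B := t.m_natural_left f.hom a B
  m_natural_right f A _ _ b := t.m_natural_right f.hom A b
  m_comp f g A B := t.m_comp f.hom g.hom A B

section

variable {H : FiberedCat.{v', u'} 𝒮} (t : TensorStr H) {X : 𝒮}

/-- `A ⊗ B` -/
abbrev TensorStr.tens (A B : H.Fib X) : H.Fib X := ((t.tensor X).obj A).obj B

/-- `a ⊗ id_B` -/
abbrev TensorStr.tensL {A A' : H.Fib X} (a : A ⟶ A') (B : H.Fib X) : t.tens A B ⟶ t.tens A' B :=
  ((t.tensor X).map a).app B

/-- `id_A ⊗ b` -/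
abbrev TensorStr.tensR (A : H.Fib X) {B B' : H.Fib X} (b : B ⟶ B') : t.tens A B ⟶ t.tens A B' :=
  ((t.tensor X).obj A).map b

end

/-- An internal associativity constraint. -/
@[ext]
structure AssocConstraint {H : FiberedCat.{v', u'} 𝒮} (t : TensorStr H) where
  a : ∀ {X : 𝒮} (A B C : H.Fib X), t.tens (t.tens A B) C ≅ t.tens A (t.tens B C)
  natural₁ : ∀ {X : 𝒮} {A A' : H.Fib X} (x : A ⟶ A') (B C : H.Fib X),
    t.tensL (t.tensL x B) C ≫ (a A' B C).hom = (a A B C).hom ≫ t.tensL x (t.tens B C)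
  natural₂ : ∀ {X : 𝒮} (A : H.Fib X) {B B' : H.Fib X} (y : B ⟶ B') (C : H.Fib X),
    t.tensL (t.tensR A y) C ≫ (a A B' C).hom = (a A B C).hom ≫ t.tensR A (t.tensL y C)
  natural₃ : ∀ {X : 𝒮} (A B : H.Fib X) {C C' : H.Fib X} (z : C ⟶ C'),
    t.tensR (t.tens A B) z ≫ (a A B C').hom = (a A B C).hom ≫ t.tensR A (t.tensR B z)
  pentagon : ∀ {X : 𝒮} (A B C D : H.Fib X),
    (a (t.tens A B) C D).hom ≫ (a A B (t.tens C D)).hom =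
      t.tensL (a A B C).hom D ≫ (a A (t.tens B C) D).hom ≫ t.tensR A (a B C D).hom
  pull_comm : ∀ {T X : 𝒮} (f : T ⟶ X) (A B C : H.Fib X),
    t.tensL (t.m f A B).hom ((H.pull f).obj C) ≫ (t.m f (t.tens A B) C).hom ≫
        (H.pull f).map (a A B C).hom =
      (a ((H.pull f).obj A) ((H.pull f).obj B) ((H.pull f).obj C)).hom ≫
        t.tensR ((H.pull f).obj A) (t.m f B C).hom ≫ (t.m f A (t.tens B C)).hom

/-- Restriction of internal associativity constraints. -/
def AssocConstraint.restrict {H : FiberedCat.{v', u'} 𝒮} {t : TensorStr H}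
    (a : AssocConstraint t) (P : ObjectProperty 𝒮) : AssocConstraint (t.restrict P) where
  a {X} A B C := a.a (X := X.obj) A B C
  natural₁ {X} _ _ x B C := a.natural₁ (X := X.obj) x B C
  natural₂ {X} A _ _ y C := a.natural₂ (X := X.obj) A y C
  natural₃ {X} A B _ _ z := a.natural₃ (X := X.obj) A B z
  pentagon {X} A B C D := a.pentagon (X := X.obj) A B C D
  pull_comm f A B C := a.pull_comm f.hom A B C

/-- An internal commutativity constraint. -/
@[ext]
structure CommConstraint {H : FiberedCat.{v', u'} 𝒮} (t : TensorStr H) where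
  c : ∀ {X : 𝒮} (A B : H.Fib X), t.tens A B ≅ t.tens B A
  natural_left : ∀ {X : 𝒮} {A A' : H.Fib X} (x : A ⟶ A') (B : H.Fib X),
    t.tensL x B ≫ (c A' B).hom = (c A B).hom ≫ t.tensR B x
  natural_right : ∀ {X : 𝒮} (A : H.Fib X) {B B' : H.Fib X} (y : B ⟶ B'),
    t.tensR A y ≫ (c A B').hom = (c A B).hom ≫ t.tensL y A
  symm : ∀ {X : 𝒮} (A B : H.Fib X), (c A B).hom ≫ (c B A).hom = 𝟙 (t.tens A B)
  pull_comm : ∀ {T X : 𝒮} (f : T ⟶ X) (A B : H.Fib X),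
    (t.m f A B).hom ≫ (H.pull f).map (c A B).hom =
      (c ((H.pull f).obj A) ((H.pull f).obj B)).hom ≫ (t.m f B A).hom

/-- Restriction of internal commutativity constraints. -/
def CommConstraint.restrict {H : FiberedCat.{v', u'} 𝒮} {t : TensorStr H}
    (c : CommConstraint t) (P : ObjectProperty 𝒮) : CommConstraint (t.restrict P) where
  c {X} A B := c.c (X := X.obj) A B
  natural_left {X} _ _ x B := c.natural_left (X := X.obj) x B
  natural_right {X} A _ _ y := c.natural_right (X := X.obj) A y
  symm {X} A B := c.symm (X := X.obj) A B
  pull_comm f A B := c.pull_comm f.hom A B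

/-- An internal unit constraint with unit section `one`. -/
@[ext]
structure UnitConstraint {H : FiberedCat.{v', u'} 𝒮} (t : TensorStr H) (one : Sect H) where
  r : ∀ {X : 𝒮} (A : H.Fib X), t.tens A (one.obj X) ≅ A
  l : ∀ {X : 𝒮} (B : H.Fib X), t.tens (one.obj X) B ≅ B
  r_natural : ∀ {X : 𝒮} {A A' : H.Fib X} (x : A ⟶ A'),
    t.tensL x (one.obj X) ≫ (r A').hom = (r A).hom ≫ x
  l_natural : ∀ {X : 𝒮} {B B' : H.Fib X} (y : B ⟶ B'),
    t.tensR (one.obj X) y ≫ (l B').hom = (l B).hom ≫ y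
  r_one_eq_l_one : ∀ X : 𝒮, (r (one.obj X)).hom = (l (one.obj X)).hom
  pull_r : ∀ {T X : 𝒮} (f : T ⟶ X) (A : H.Fib X),
    t.tensR ((H.pull f).obj A) (one.iso f).hom ≫ (r ((H.pull f).obj A)).hom =
      (t.m f A (one.obj X)).hom ≫ (H.pull f).map (r A).hom
  pull_l : ∀ {T X : 𝒮} (f : T ⟶ X) (B : H.Fib X),
    t.tensL (one.iso f).hom ((H.pull f).obj B) ≫ (l ((H.pull f).obj B)).hom =
      (t.m f (one.obj X) B).hom ≫ (H.pull f).map (l B).hom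

/-- Restriction of internal unit constraints. -/
def UnitConstraint.restrict {H : FiberedCat.{v', u'} 𝒮} {t : TensorStr H} {one : Sect H}
    (e : UnitConstraint t one) (P : ObjectProperty 𝒮) :
    UnitConstraint (t.restrict P) (one.restrict P) where
  r {X} A := e.r (X := X.obj) A
  l {X} B := e.l (X := X.obj) B
  r_natural {X} _ _ x := e.r_natural (X := X.obj) x
  l_natural {X} _ _ y := e.l_natural (X := X.obj) y
  r_one_eq_l_one X := e.r_one_eq_l_one X.obj
  pull_r f A := e.pull_r f.hom A
  pull_l f B := e.pull_l f.hom B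

/-! ### Tensor structures on morphisms -/

section MorTensor

variable {H₁ : FiberedCat.{v', u'} 𝒮} {H₂ : FiberedCat.{v'', u''} 𝒮}

/-- An internal tensor structure `ρ` on a morphism `R` with respect to `(⊗₁, m₁)`, `(⊗₂, m₂)`. -/
@[ext]
structure MorTensor (R : Mor H₁ H₂) (t₁ : TensorStr H₁) (t₂ : TensorStr H₂) where
  /-- `ρ_X : R_X(A) ⊗₂ R_X(B) ≅ R_X(A ⊗₁ B)` -/
  ρ : ∀ {X : 𝒮} (A B : H₁.Fib X),
    t₂.tens ((R.R X).obj A) ((R.R X).obj B) ≅ (R.R X).obj (t₁.tens A B)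
  natural_left : ∀ {X : 𝒮} {A A' : H₁.Fib X} (x : A ⟶ A') (B : H₁.Fib X),
    t₂.tensL ((R.R X).map x) ((R.R X).obj B) ≫ (ρ A' B).hom =
      (ρ A B).hom ≫ (R.R X).map (t₁.tensL x B)
  natural_right : ∀ {X : 𝒮} (A : H₁.Fib X) {B B' : H₁.Fib X} (y : B ⟶ B'),
    t₂.tensR ((R.R X).obj A) ((R.R X).map y) ≫ (ρ A B').hom =
      (ρ A B).hom ≫ (R.R X).map (t₁.tensR A y)
  pull_comm : ∀ {T X : 𝒮} (f : T ⟶ X) (A B : H₁.Fib X),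
    (t₂.m f ((R.R X).obj A) ((R.R X).obj B)).hom ≫ (H₂.pull f).map (ρ A B).hom ≫
        (R.θ f).hom.app (t₁.tens A B) =
      t₂.tensL ((R.θ f).hom.app A) ((H₂.pull f).obj ((R.R X).obj B)) ≫
        t₂.tensR ((R.R T).obj ((H₁.pull f).obj A)) ((R.θ f).hom.app B) ≫
        (ρ ((H₁.pull f).obj A) ((H₁.pull f).obj B)).hom ≫ (R.R T).map (t₁.m f A B).hom

variable {R : Mor H₁ H₂} {t₁ : TensorStr H₁} {t₂ : TensorStr H₂}

/-- Restriction of internal tensor structures on morphisms. -/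
def MorTensor.restrict (ρ : MorTensor R t₁ t₂) (P : ObjectProperty 𝒮) :
    MorTensor (R.restrict P) (t₁.restrict P) (t₂.restrict P) where
  ρ {X} A B := ρ.ρ (X := X.obj) A B
  natural_left {X} _ _ x B := ρ.natural_left (X := X.obj) x B
  natural_right {X} A _ _ y := ρ.natural_right (X := X.obj) A y
  pull_comm f A B := ρ.pull_comm f.hom A B

/-- `ρ` is associative with respect to `a₁` and `a₂`. -/
def MorTensor.IsAssociative (ρ : MorTensor R t₁ t₂) (a₁ : AssocConstraint t₁)
    (a₂ : AssocConstraint t₂) : Prop :=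
  ∀ {X : 𝒮} (A B C : H₁.Fib X),
    t₂.tensL (ρ.ρ A B).hom ((R.R X).obj C) ≫ (ρ.ρ (t₁.tens A B) C).hom ≫
        (R.R X).map (a₁.a A B C).hom =
      (a₂.a ((R.R X).obj A) ((R.R X).obj B) ((R.R X).obj C)).hom ≫
        t₂.tensR ((R.R X).obj A) (ρ.ρ B C).hom ≫ (ρ.ρ A (t₁.tens B C)).hom

/-- `ρ` is symmetric with respect to `c₁` and `c₂`. -/
def MorTensor.IsSymmetric (ρ : MorTensor R t₁ t₂) (c₁ : CommConstraint t₁)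
    (c₂ : CommConstraint t₂) : Prop :=
  ∀ {X : 𝒮} (A B : H₁.Fib X),
    (ρ.ρ A B).hom ≫ (R.R X).map (c₁.c A B).hom =
      (c₂.c ((R.R X).obj A) ((R.R X).obj B)).hom ≫ (ρ.ρ B A).hom

/-- `ρ` is unitary via `w : R(1₁) ≅ 1₂` with respect to `e₁` and `e₂`. -/
def MorTensor.IsUnitary (ρ : MorTensor R t₁ t₂) {one₁ : Sect H₁} {one₂ : Sect H₂}
    (e₁ : UnitConstraint t₁ one₁) (e₂ : UnitConstraint t₂ one₂)
    (w : SectIso (R.sect one₁) one₂) : Prop :=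
  (∀ {X : 𝒮} (A : H₁.Fib X),
    t₂.tensR ((R.R X).obj A) (w.iso X).hom ≫ (e₂.r ((R.R X).obj A)).hom =
      (ρ.ρ A (one₁.obj X)).hom ≫ (R.R X).map (e₁.r A).hom) ∧
  (∀ {X : 𝒮} (B : H₁.Fib X),
    t₂.tensL (w.iso X).hom ((R.R X).obj B) ≫ (e₂.l ((R.R X).obj B)).hom =
      (ρ.ρ (one₁.obj X) B).hom ≫ (R.R X).map (e₁.l B).hom)

end MorTensor

/-! ### Triangulated structures -/

/-- A triangulated fibered category: the fibers are triangulated categories, inverse images are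
triangulated functors and connection isomorphisms are compatible with shifts. -/
class FiberedCat.Triangulated (H : FiberedCat.{v', u'} 𝒮) where
  [zero : ∀ X, HasZeroObject (H.Fib X)]
  [preadditive : ∀ X, Preadditive (H.Fib X)]
  [shift : ∀ X, HasShift (H.Fib X) ℤ]
  [shift_additive : ∀ (X : 𝒮) (n : ℤ), (shiftFunctor (H.Fib X) n).Additive]
  [pretriangulated : ∀ X, Pretriangulated (H.Fib X)]
  [triangulated : ∀ X, CategoryTheory.IsTriangulated (H.Fib X)]
  [pullShift : ∀ {T X : 𝒮} (f : T ⟶ X), (H.pull f).CommShift ℤ]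
  [pull_triangulated : ∀ {T X : 𝒮} (f : T ⟶ X), (H.pull f).IsTriangulated]
  conn_shift : ∀ {T X V : 𝒮} (f : T ⟶ X) (g : X ⟶ V) (h : T ⟶ V) (w : f ≫ g = h),
    NatTrans.CommShift (H.conn f g h w).hom ℤ

attribute [reducible] FiberedCat.Triangulated.preadditive FiberedCat.Triangulated.shift
  FiberedCat.Triangulated.pretriangulated FiberedCat.Triangulated.pullShift

attribute [instance] FiberedCat.Triangulated.zero FiberedCat.Triangulated.preadditive
  FiberedCat.Triangulated.shift FiberedCat.Triangulated.shift_additive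
  FiberedCat.Triangulated.pretriangulated FiberedCat.Triangulated.triangulated
  FiberedCat.Triangulated.pullShift FiberedCat.Triangulated.pull_triangulated

instance (H : FiberedCat.{v', u'} 𝒮) [h : H.Triangulated] (P : ObjectProperty 𝒮) :
    (H.restrict P).Triangulated where
  zero X := h.zero X.obj
  preadditive X := h.preadditive X.obj
  shift X := h.shift X.obj
  shift_additive X n := h.shift_additive X.obj n
  pretriangulated X := h.pretriangulated X.obj
  triangulated X := h.triangulated X.obj
  pullShift f := h.pullShift f.hom
  pull_triangulated f := h.pull_triangulated f.hom
  conn_shift f g k w := h.conn_shift f.hom g.hom k.hom (by rw [← w]; rfl)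

/-- A triangulated morphism: every `R_X` is a triangulated functor, and the isomorphisms `θ` are
compatible with shifts. -/
class Mor.Triangulated {H₁ : FiberedCat.{v', u'} 𝒮} {H₂ : FiberedCat.{v'', u''} 𝒮}
    [H₁.Triangulated] [H₂.Triangulated] (R : Mor H₁ H₂) where
  [shift : ∀ X : 𝒮, (R.R X).CommShift ℤ]
  [triangulated : ∀ X : 𝒮, (R.R X).IsTriangulated]
  θ_shift : ∀ {T X : 𝒮} (f : T ⟶ X), NatTrans.CommShift (R.θ f).hom ℤ

attribute [reducible] Mor.Triangulated.shift

attribute [instance] Mor.Triangulated.shift Mor.Triangulated.triangulated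

instance {H₁ : FiberedCat.{v', u'} 𝒮} {H₂ : FiberedCat.{v'', u''} 𝒮}
    [H₁.Triangulated] [H₂.Triangulated] (R : Mor H₁ H₂) [h : R.Triangulated]
    (P : ObjectProperty 𝒮) : (R.restrict P).Triangulated where
  shift X := h.shift X.obj
  triangulated X := h.triangulated X.obj
  θ_shift f := h.θ_shift f.hom

section

variable {C : Type u'} [Category.{v'} C] [Preadditive C] [HasShift C ℤ]
  [∀ n : ℤ, (shiftFunctor C n).Additive] (F : C ⥤ C ⥤ C) [F.CommShift₂Int]

/-- `A⟦n⟧ ⊗ B ⟶ (A ⊗ B)⟦n⟧` for a bifunctor `⊗` commuting with shifts. -/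
noncomputable abbrev shiftL (A B : C) (n : ℤ) :
    (F.obj (A⟦n⟧)).obj B ⟶ ((F.obj A).obj B)⟦n⟧ :=
  ((F.flip.obj B).commShiftIso n).hom.app A

/-- `A ⊗ B⟦n⟧ ⟶ (A ⊗ B)⟦n⟧` for a bifunctor `⊗` commuting with shifts. -/
noncomputable abbrev shiftR (A B : C) (n : ℤ) :
    (F.obj A).obj (B⟦n⟧) ⟶ ((F.obj A).obj B)⟦n⟧ :=
  ((F.obj A).commShiftIso n).hom.app B

end

/-- A triangulated internal tensor structure: every `⊗` is triangulated in each variable (with the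
usual sign rule for the two shifts), and the isomorphisms `m` are compatible with shifts in each
variable. -/
class TensorStr.Triangulated {H : FiberedCat.{v', u'} 𝒮} [H.Triangulated]
    (t : TensorStr H) where
  [shift : ∀ X : 𝒮, (t.tensor X).CommShift₂Int]
  triangulated_left : ∀ {X : 𝒮} (B : H.Fib X), ((t.tensor X).flip.obj B).IsTriangulated
  triangulated_right : ∀ {X : 𝒮} (A : H.Fib X), ((t.tensor X).obj A).IsTriangulated
  m_shift_left : ∀ {T X : 𝒮} (f : T ⟶ X) (A B : H.Fib X) (n : ℤ),
    (t.m f (A⟦n⟧) B).hom ≫ (H.pull f).map (shiftL (t.tensor X) A B n) ≫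
        ((H.pull f).commShiftIso n).hom.app (t.tens A B) =
      t.tensL (((H.pull f).commShiftIso n).hom.app A) ((H.pull f).obj B) ≫
        shiftL (t.tensor T) ((H.pull f).obj A) ((H.pull f).obj B) n ≫ (t.m f A B).hom⟦n⟧'
  m_shift_right : ∀ {T X : 𝒮} (f : T ⟶ X) (A B : H.Fib X) (n : ℤ),
    (t.m f A (B⟦n⟧)).hom ≫ (H.pull f).map (shiftR (t.tensor X) A B n) ≫
        ((H.pull f).commShiftIso n).hom.app (t.tens A B) =
      t.tensR ((H.pull f).obj A) (((H.pull f).commShiftIso n).hom.app B) ≫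
        shiftR (t.tensor T) ((H.pull f).obj A) ((H.pull f).obj B) n ≫ (t.m f A B).hom⟦n⟧'

attribute [reducible] TensorStr.Triangulated.shift

attribute [instance] TensorStr.Triangulated.shift

instance {H : FiberedCat.{v', u'} 𝒮} [H.Triangulated] (t : TensorStr H) [h : t.Triangulated]
    (P : ObjectProperty 𝒮) : (t.restrict P).Triangulated where
  shift X := h.shift X.obj
  triangulated_left {X} B := h.triangulated_left (X := X.obj) B
  triangulated_right {X} A := h.triangulated_right (X := X.obj) A
  m_shift_left f A B n := h.m_shift_left f.hom A B n
  m_shift_right f A B n := h.m_shift_right f.hom A B n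

/-- A triangulated internal tensor structure on a triangulated morphism: every `ρ_X` is compatible
with shifts in each variable. -/
structure MorTensor.IsTriangulated {H₁ : FiberedCat.{v', u'} 𝒮} {H₂ : FiberedCat.{v'', u''} 𝒮}
    [H₁.Triangulated] [H₂.Triangulated] {R : Mor H₁ H₂} [R.Triangulated]
    {t₁ : TensorStr H₁} {t₂ : TensorStr H₂} [t₁.Triangulated] [t₂.Triangulated]
    (ρ : MorTensor R t₁ t₂) : Prop where
  shift_left : ∀ {X : 𝒮} (A B : H₁.Fib X) (n : ℤ),
    (ρ.ρ (A⟦n⟧) B).hom ≫ (R.R X).map (shiftL (t₁.tensor X) A B n) ≫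
        ((R.R X).commShiftIso n).hom.app (t₁.tens A B) =
      t₂.tensL (((R.R X).commShiftIso n).hom.app A) ((R.R X).obj B) ≫
        shiftL (t₂.tensor X) ((R.R X).obj A) ((R.R X).obj B) n ≫ (ρ.ρ A B).hom⟦n⟧'
  shift_right : ∀ {X : 𝒮} (A B : H₁.Fib X) (n : ℤ),
    (ρ.ρ A (B⟦n⟧)).hom ≫ (R.R X).map (shiftR (t₁.tensor X) A B n) ≫
        ((R.R X).commShiftIso n).hom.app (t₁.tens A B) =
      t₂.tensR ((R.R X).obj A) (((R.R X).commShiftIso n).hom.app B) ≫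
        shiftR (t₂.tensor X) ((R.R X).obj A) ((R.R X).obj B) n ≫ (ρ.ρ A B).hom⟦n⟧'

/-! ### Localic structures -/

section Localic

/-- The exchange map `p'_# f'^* A ⟶ f^* p_# A` of a commutative square. -/
def exchange (H : FiberedCat.{v', u'} 𝒮) {Q P T X : 𝒮} {f' : Q ⟶ P} {p' : Q ⟶ T}
    {p : P ⟶ X} {f : T ⟶ X} (sq : f' ≫ p = p' ≫ f)
    {L : H.Fib P ⥤ H.Fib X} (adj : L ⊣ H.pull p)
    {L' : H.Fib Q ⥤ H.Fib T} (adj' : L' ⊣ H.pull p') (A : H.Fib P) :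
    L'.obj ((H.pull f').obj A) ⟶ (H.pull f).obj (L.obj A) :=
  L'.map ((H.pull f').map (adj.unit.app A)) ≫
    L'.map ((H.conn f' p (f' ≫ p) rfl).inv.app (L.obj A)) ≫
    L'.map ((H.conn p' f (f' ≫ p) sq.symm).hom.app (L.obj A)) ≫
    adj'.counit.app ((H.pull f).obj (L.obj A))

variable [HasFiniteProducts 𝒮] [HasInitial 𝒮] (G : Geometry 𝒮)

/-- A localic triangulated fibered category. -/
structure FiberedCat.IsLocalic (H : FiberedCat.{v', u'} 𝒮) [H.Triangulated] : Prop where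
  fib_empty : ∀ A : H.Fib (⊥_ 𝒮), IsZero A
  sharp : ∀ {P X : 𝒮} (p : P ⟶ X), G.sm p → (H.pull p).IsRightAdjoint
  exchange_isIso : ∀ {Q P T X : 𝒮} {f' : Q ⟶ P} {p' : Q ⟶ T} {p : P ⟶ X} {f : T ⟶ X}
    (sq : IsPullback f' p' p f), G.sm p →
    ∀ {L : H.Fib P ⥤ H.Fib X} (adj : L ⊣ H.pull p)
      {L' : H.Fib Q ⥤ H.Fib T} (adj' : L' ⊣ H.pull p') (A : H.Fib P),
      IsIso (exchange H sq.w adj adj' A)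
  direct_image : ∀ {Z X : 𝒮} (z : Z ⟶ X), G.cl z →
    ∃ D : H.Fib Z ⥤ H.Fib X, Nonempty (H.pull z ⊣ D) ∧ D.Full ∧ D.Faithful
  conservative : ∀ {Z W X : 𝒮} (z : Z ⟶ X) (w : W ⟶ X), G.cl z → IsOpenComplement G.sm z w →
    ∀ {A B : H.Fib X} (x : A ⟶ B),
      IsIso ((H.pull z).map x) → IsIso ((H.pull w).map x) → IsIso x

/-- A localic morphism: a triangulated morphism for which the natural map
`p_# R_P(A) ⟶ R_X(p_# A)` is invertible for every smooth `p : P ⟶ X`. -/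
def Mor.IsLocalic {H₁ : FiberedCat.{v', u'} 𝒮} {H₂ : FiberedCat.{v'', u''} 𝒮}
    [H₁.Triangulated] [H₂.Triangulated] (R : Mor H₁ H₂) [R.Triangulated] : Prop :=
  ∀ {P X : 𝒮} (p : P ⟶ X), G.sm p →
    ∀ {L₁ : H₁.Fib P ⥤ H₁.Fib X} (adj₁ : L₁ ⊣ H₁.pull p)
      {L₂ : H₂.Fib P ⥤ H₂.Fib X} (adj₂ : L₂ ⊣ H₂.pull p) (A : H₁.Fib P),
      IsIso (L₂.map ((R.R P).map (adj₁.unit.app A)) ≫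
        L₂.map ((R.θ p).inv.app (L₁.obj A)) ≫ adj₂.counit.app ((R.R X).obj (L₁.obj A)))

/-- A localic internal tensor structure: a triangulated one that satisfies the projection
formulae along smooth morphisms. -/
structure TensorStr.IsLocalic {H : FiberedCat.{v', u'} 𝒮} [H.Triangulated]
    (t : TensorStr H) [t.Triangulated] : Prop where
  proj_left : ∀ {P X : 𝒮} (p : P ⟶ X), G.sm p →
    ∀ {L : H.Fib P ⥤ H.Fib X} (adj : L ⊣ H.pull p) (A : H.Fib P) (B : H.Fib X),
      IsIso (L.map (t.tensL (adj.unit.app A) ((H.pull p).obj B)) ≫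
        L.map (t.m p (L.obj A) B).hom ≫ adj.counit.app (t.tens (L.obj A) B))
  proj_right : ∀ {P X : 𝒮} (p : P ⟶ X), G.sm p →
    ∀ {L : H.Fib P ⥤ H.Fib X} (adj : L ⊣ H.pull p) (A : H.Fib X) (B : H.Fib P),
      IsIso (L.map (t.tensR ((H.pull p).obj A) (adj.unit.app B)) ≫
        L.map (t.m p A (L.obj B)).hom ≫ adj.counit.app (t.tens A (L.obj B)))

end Localic

end Defs

end FibExt

open FibExt

/-! Factoring `X ⟶ *` shows that every `X` has a closed immersion `z : X ⟶ P` with `P` in `𝒰`. Since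
`z_*` is fully faithful, the counit `z^* z_* ⟶ id` is invertible: every object over `X` is, up to
isomorphism, pulled back from `P`, and a natural isomorphism between functors on the fiber over `X`
amounts to one between their composites with `z^*`. A natural isomorphism over `X` that commutes
with `z^*` is therefore determined by the one over `P`, and the one over `P` always induces one over
`X`.

Independence of the embedding is the diagonal trick. For any `g : X ⟶ Q` with `Q` in `𝒰`, the map
`(z, g) : X ⟶ P ⨯ Q` is again a closed immersion, because composing it with the first projection
gives `z`, and `P ⨯ Q` lies in `𝒰`. The isomorphism it induces over `X` is compatible with both
projections, so it equals the one induced by `z` and is compatible with `g`. For arbitrary `f : T ⟶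
X`, this applies to `f ≫ z`, and `z` is cancelled by essential surjectivity of `z^*`. This is
`PseudoMor.exists_extension`.

A tensor structure `ρ` and the constraints `a`, `c`, `u` are natural isomorphisms commuting with
inverse images, in one, two or three variables. Several variables are reduced to one by fiberwise
products of fibered categories, whose inverse images along closed immersions again have fully
faithful right adjoints. Hence all these data extend uniquely as natural isomorphisms.

The remaining conditions (pentagon, symmetry, compatibility of `ρ` with constraints and with shifts)
are identities between natural transformations. By naturality they may be checked on objects `z^*
A`, where they follow from `z^*` of the identity over `P`: these are the lemmas named `..._of_pull`.
Agreement of the two units on `1 ⊗ 1` passes along any inverse image through the unit section.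
Sections and their isomorphisms are governed by their value on `*`, which lies in `𝒰`. -/

namespace FibExt

/-! ### Functors with a fully faithful right adjoint -/

section Reflection

variable {C D E C' D' : Type*} [Category* C] [Category* D] [Category* E] [Category* C']
  [Category* D']

/-- A functor which has a fully faithful right adjoint. -/
def IsReflection (Z : C ⥤ D) : Prop :=
  ∃ N : D ⥤ C, Nonempty (Z ⊣ N) ∧ N.Full ∧ N.Faithful

/-- The counit is invertible because the right adjoint is fully faithful. Checking identities on
pulled-back objects rests on this consequence alone. -/
lemma IsReflection.essSurj {Z : C ⥤ D} (h : IsReflection Z) : Z.EssSurj := by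
  obtain ⟨N, ⟨adj⟩, _, _⟩ := h
  exact ⟨fun A => ⟨N.obj A, ⟨asIso (adj.counit.app A)⟩⟩⟩

/-- Lets transformations in two or three variables be treated as transformations in one. -/
lemma IsReflection.prod {Z : C ⥤ D} {Z' : C' ⥤ D'} (h : IsReflection Z) (h' : IsReflection Z') :
    IsReflection (Z.prod Z') := by
  obtain ⟨N, ⟨adj⟩, _, _⟩ := h
  obtain ⟨N', ⟨adj'⟩, _, _⟩ := h'
  refine ⟨N.prod N', ⟨Adjunction.mkOfUnitCounit
    { unit := { app := fun A => (adj.unit.app A.1, adj'.unit.app A.2) }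
      counit := { app := fun A => (adj.counit.app A.1, adj'.counit.app A.2) } }⟩, ⟨?_⟩, ⟨?_⟩⟩
  · intro A B x
    exact ⟨(N.preimage x.1, N'.preimage x.2), by ext <;> simp⟩
  · intro A B x y e
    have e₁ := congrArg Prod.fst e
    have e₂ := congrArg Prod.snd e
    exact Prod.ext (N.map_injective e₁) (N'.map_injective e₂)

lemma natTrans_ext_of_essSurj {Z : C ⥤ D} (h : Z.EssSurj) {F F' : D ⥤ E} {α β : F ⟶ F'}
    (e : ∀ A, α.app (Z.obj A) = β.app (Z.obj A)) : α = β := by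
  ext B
  rw [← cancel_epi (F.map (Z.objObjPreimageIso B).hom), α.naturality, β.naturality, e]

/-- Natural isomorphisms descend along a reflection. -/
lemma IsReflection.exists_natIso {Z : C ⥤ D} (h : IsReflection Z) {F F' : D ⥤ E}
    (β : Z ⋙ F ≅ Z ⋙ F') : ∃ α : F ≅ F', ∀ A, α.hom.app (Z.obj A) = β.hom.app A := by
  obtain ⟨N, ⟨adj⟩, _, _⟩ := h
  -- At `B`, take `β` at `N B` and conjugate by the counit `Z N B ≅ B`.
  refine ⟨NatIso.ofComponents (fun B => F.mapIso (asIso (adj.counit.app B)).symm ≪≫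
    β.app (N.obj B) ≪≫ F'.mapIso (asIso (adj.counit.app B))) ?_, fun A => ?_⟩
  · intro A B x
    have h₁ := β.hom.naturality (N.map x)
    have h₂ := adj.counit.naturality x
    dsimp at h₁ h₂ ⊢
    have h₃ : x ≫ inv (adj.counit.app B) = inv (adj.counit.app A) ≫ Z.map (N.map x) := by
      rw [IsIso.comp_inv_eq, Category.assoc, h₂, IsIso.inv_hom_id_assoc]
    simp only [Category.assoc, ← F'.map_comp, ← h₂]
    rw [← F.map_comp_assoc, h₃, F.map_comp_assoc, reassoc_of% h₁, F'.map_comp]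
  -- At `Z A` the triangle identity makes the inverse of the counit equal to `Z` of the unit, so
  -- naturality of `β` along the unit gives back `β` at `A`.
  · have h₁ := β.hom.naturality (adj.unit.app A)
    have h₂ : inv (adj.counit.app (Z.obj A)) = Z.map (adj.unit.app A) :=
      IsIso.inv_eq_of_inv_hom_id (adj.left_triangle_components A)
    dsimp at h₁ ⊢
    rw [h₂, reassoc_of% h₁, ← F'.map_comp, adj.left_triangle_components, F'.map_id,
      Category.comp_id]

end Reflection

/-! ### Objects smooth over the base -/

section Base

variable {𝒮 : Type u} [Category.{v} 𝒮] [HasFiniteProducts 𝒮] [HasInitial 𝒮] (G : Geometry 𝒮)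

lemma Geometry.U_terminal : G.U (⊤_ 𝒮) := by
  rw [Geometry.U, Subsingleton.elim (terminal.from (⊤_ 𝒮)) (𝟙 _)]
  exact G.sm_of_iso _ (MorphismProperty.isomorphisms.infer_property _)

/-- The projection to `Q` is a base change of `P ⟶ *`, and smooth morphisms compose. -/
lemma Geometry.U_prod {P Q : 𝒮} (hP : G.U P) (hQ : G.U Q) : G.U (P ⨯ Q) := by
  have := G.sm_multiplicative
  have h : G.sm (prod.snd : P ⨯ Q ⟶ Q) := G.sm_baseChange
    (IsPullback.of_is_product (prodIsProd P Q) terminalIsTerminal :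
      IsPullback prod.fst prod.snd (terminal.from P) (terminal.from Q)) hP
  have h' := G.sm.comp_mem _ _ h hQ
  rwa [Subsingleton.elim (prod.snd ≫ terminal.from Q) (terminal.from (P ⨯ Q))] at h'

lemma Geometry.exists_embedding (X : 𝒮) : ∃ (P : 𝒮) (z : X ⟶ P), G.U P ∧ G.cl z := by
  obtain ⟨P, z, p, hz, hp, -⟩ := G.factorization (terminal.from X)
  exact ⟨P, z, by rwa [Subsingleton.elim p (terminal.from P)] at hp, hz⟩

/-- Cancellation against the first projection. That `g` is arbitrary is what yields compatibility
with all morphisms from `X` to `𝒰`, not just with closed immersions. -/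
lemma Geometry.cl_lift {X P Q : 𝒮} (z : X ⟶ P) (g : X ⟶ Q) (hz : G.cl z) :
    G.cl (prod.lift z g) :=
  G.cl_cancel _ prod.fst (by rwa [prod.lift_fst])

end Base

/-! ### Natural isomorphisms commuting with inverse images -/

section Extension

variable {𝒮 : Type u} [Category.{v} 𝒮]

/-- A family of functors `F_X` between the fibers of two fibered categories, with coherent
comparison isomorphisms `F_T(f^* A) ≅ f^* F_X(A)`. -/
structure PseudoMor {𝒮 : Type u} [Category.{v} 𝒮] (K : FiberedCat.{v', u'} 𝒮)
    (L : FiberedCat.{v'', u''} 𝒮) where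
  F : ∀ X : 𝒮, K.Fib X ⥤ L.Fib X
  φ : ∀ {T X : 𝒮} (f : T ⟶ X) (A : K.Fib X),
    (F T).obj ((K.pull f).obj A) ≅ (L.pull f).obj ((F X).obj A)
  natural : ∀ {T X : 𝒮} (f : T ⟶ X) {A B : K.Fib X} (x : A ⟶ B),
    (F T).map ((K.pull f).map x) ≫ (φ f B).hom = (φ f A).hom ≫ (L.pull f).map ((F X).map x)
  comp : ∀ {T X V : 𝒮} (f : T ⟶ X) (g : X ⟶ V) (A : K.Fib V),
    (φ (f ≫ g) A).hom ≫ (L.conn f g (f ≫ g) rfl).hom.app ((F V).obj A) =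
      (F T).map ((K.conn f g (f ≫ g) rfl).hom.app A) ≫ (φ f ((K.pull g).obj A)).hom ≫
        (L.pull f).map (φ g A).hom

variable {K : FiberedCat.{v', u'} 𝒮} {L : FiberedCat.{v'', u''} 𝒮}

/-- The natural transformations `α` and `β` correspond to each other under inverse image
along `f`. -/
def PseudoMor.Compatible (F F' : PseudoMor K L) {T X : 𝒮} (f : T ⟶ X) (α : F.F T ⟶ F'.F T)
    (β : F.F X ⟶ F'.F X) : Prop :=
  ∀ A : K.Fib X, (F.φ f A).hom ≫ (L.pull f).map (β.app A) =
    α.app ((K.pull f).obj A) ≫ (F'.φ f A).hom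

namespace PseudoMor.Compatible

variable {F F' : PseudoMor K L} {T X V : 𝒮}

lemma comp {f : T ⟶ X} {g : X ⟶ V} {α : F.F T ⟶ F'.F T} {β : F.F X ⟶ F'.F X}
    {γ : F.F V ⟶ F'.F V} (h : F.Compatible F' f α β) (h' : F.Compatible F' g β γ) :
    F.Compatible F' (f ≫ g) α γ := by
  intro A
  have h₁ := h ((K.pull g).obj A)
  have h₂ := congrArg (L.pull f).map (h' A)
  have h₃ := F.comp f g A
  have h₄ := F'.comp f g A
  have h₅ := (L.conn f g (f ≫ g) rfl).hom.naturality (γ.app A)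
  have h₆ := α.naturality ((K.conn f g (f ≫ g) rfl).hom.app A)
  simp only [Functor.comp_obj, Functor.comp_map, Functor.map_comp] at h₂ h₅ h₆
  rw [← cancel_mono ((L.conn f g (f ≫ g) rfl).hom.app ((F'.F V).obj A)), Category.assoc,
    Category.assoc, h₄, h₅, reassoc_of% h₃, ← reassoc_of% h₆, ← reassoc_of% h₁, h₂]

lemma eq {f : T ⟶ X} {α α' : F.F T ⟶ F'.F T} {β : F.F X ⟶ F'.F X} (hf : (K.pull f).EssSurj)
    (h : F.Compatible F' f α β) (h' : F.Compatible F' f α' β) : α = α' :=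
  natTrans_ext_of_essSurj hf fun A => by
    rw [← cancel_mono (F'.φ f A).hom, ← h A, ← h' A]

/-- Cancellation of `g` in `Compatible.comp`: the coherence of `φ` for `f ≫ g` gives the identity on
objects `g^* A`, and these exhaust the fiber over `X` up to isomorphism. -/
lemma of_comp {f : T ⟶ X} {g : X ⟶ V} {α : F.F T ⟶ F'.F T} {β : F.F X ⟶ F'.F X}
    {γ : F.F V ⟶ F'.F V} (hg : (K.pull g).EssSurj) (h : F.Compatible F' (f ≫ g) α γ)
    (h' : F.Compatible F' g β γ) : F.Compatible F' f α β := by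
  have key : ∀ A, (F.φ f ((K.pull g).obj A)).hom ≫ (L.pull f).map (β.app ((K.pull g).obj A)) =
      α.app ((K.pull f).obj ((K.pull g).obj A)) ≫ (F'.φ f ((K.pull g).obj A)).hom := by
    intro A
    have h₁ := h A
    have h₂ := congrArg (L.pull f).map (h' A)
    have h₃ := F.comp f g A
    have h₄ := F'.comp f g A
    have h₅ := (L.conn f g (f ≫ g) rfl).hom.naturality (γ.app A)
    have h₆ := α.naturality ((K.conn f g (f ≫ g) rfl).hom.app A)
    simp only [Functor.comp_obj, Functor.comp_map, Functor.map_comp] at h₂ h₅ h₆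
    rw [← cancel_mono ((L.pull f).map (F'.φ g A).hom), Category.assoc, Category.assoc, ← h₂,
      ← cancel_epi ((F.F T).map ((K.conn f g (f ≫ g) rfl).hom.app A)), ← reassoc_of% h₃,
      reassoc_of% h₆, ← h₄, ← reassoc_of% h₁, h₅]
  -- Transport from `g^*` of a preimage to `B` by naturality.
  intro B
  have e := hg
  have := key ((K.pull g).objPreimage B)
  let i := (K.pull g).objObjPreimageIso B
  rw [← cancel_epi ((F.F T).map ((K.pull f).map i.hom)), reassoc_of% F.natural f i.hom,
    ← Functor.map_comp, β.naturality, Functor.map_comp, reassoc_of% this,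
    α.naturality_assoc, F'.natural]

end PseudoMor.Compatible

/-- Compatibility prescribes `α` at `f^* A` as `f^* β` conjugated by the comparison isomorphisms.
This is natural in `A`, hence descends along the reflection `f^*`. -/
lemma PseudoMor.exists_compatible (F F' : PseudoMor K L) {T X : 𝒮} (f : T ⟶ X)
    (hf : IsReflection (K.pull f)) (β : F.F X ≅ F'.F X) :
    ∃ α : F.F T ≅ F'.F T, F.Compatible F' f α.hom β.hom := by
  obtain ⟨α, hα⟩ := hf.exists_natIso (F := F.F T) (F' := F'.F T) (NatIso.ofComponents
    (fun A => F.φ f A ≪≫ (L.pull f).mapIso (β.app A) ≪≫ (F'.φ f A).symm) (by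
      intro A B x
      have h := F'.natural f x
      simp only [Functor.comp_map, Iso.trans_hom, Functor.mapIso_hom, Iso.app_hom, Iso.symm_hom,
        Category.assoc]
      rw [reassoc_of% F.natural f x, ← Functor.map_comp_assoc, β.hom.naturality,
        Functor.map_comp_assoc, ← cancel_mono (F'.φ f B).hom]
      simp only [Category.assoc, Iso.inv_hom_id, Category.comp_id, h, Iso.inv_hom_id_assoc]))
  refine ⟨α, fun A => ?_⟩
  rw [hα]
  simp

variable [HasFiniteProducts 𝒮] [HasInitial 𝒮] (G : Geometry 𝒮)

/-- A natural isomorphism over the objects smooth over the base which commutes with inverse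
images extends to all objects. -/
theorem PseudoMor.exists_extension (F F' : PseudoMor K L)
    (hK : ∀ {Z X : 𝒮} (z : Z ⟶ X), G.cl z → IsReflection (K.pull z))
    (τ : ∀ X : 𝒮, G.U X → (F.F X ≅ F'.F X))
    (hτ : ∀ {T X : 𝒮} (hT : G.U T) (hX : G.U X) (f : T ⟶ X),
      F.Compatible F' f (τ T hT).hom (τ X hX).hom) :
    ∃ τ' : ∀ X : 𝒮, F.F X ≅ F'.F X,
      (∀ {T X : 𝒮} (f : T ⟶ X), F.Compatible F' f (τ' T).hom (τ' X).hom) ∧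
      ∀ (X : 𝒮) (hX : G.U X), τ' X = τ X hX := by
  -- An arbitrary embedding is chosen even for `X` in `𝒰`; agreement of `τ'` with `τ` there is
  -- proved at the end by uniqueness.
  choose P z hP hz using G.exists_embedding
  choose τ' hτ' using fun X => F.exists_compatible F' (z X) (hK _ (hz X)) (τ _ (hP X))
  -- The diagonal trick: `α`, induced by the embedding into `P X ⨯ Q`, is compatible with `z X`
  -- through the first projection, so it is `τ' X`; the second projection then gives `g`.
  have key : ∀ {X Q : 𝒮} (g : X ⟶ Q) (hQ : G.U Q),
      F.Compatible F' g (τ' X).hom (τ Q hQ).hom := by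
    intro X Q g hQ
    have hlift := hK _ (G.cl_lift (z X) g (hz X))
    have hPQ := G.U_prod (hP X) hQ
    obtain ⟨α, hα⟩ := F.exists_compatible F' (prod.lift (z X) g) hlift (τ _ hPQ)
    have h₁ := hα.comp (hτ hPQ (hP X) prod.fst)
    have h₂ := hα.comp (hτ hPQ hQ prod.snd)
    rw [prod.lift_fst] at h₁
    rw [prod.lift_snd] at h₂
    rwa [(hτ' X).eq (hK _ (hz X)).essSurj h₁]
  refine ⟨τ', fun {T X} f => ?_, fun X hX => ?_⟩
  · exact (key (f ≫ z X) (hP X)).of_comp (hK _ (hz X)).essSurj (hτ' X)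
  · ext1
    exact (hτ' X).eq (hK _ (hz X)).essSurj (hτ hX (hP X) (z X))

end Extension

/-! ### Products of fibered categories and operations on pseudomorphisms -/

section Operations

variable {𝒮 : Type u} [Category.{v} 𝒮]

/-- The fiberwise product of two fibered categories. -/
def FiberedCat.prod (H H' : FiberedCat.{v', u'} 𝒮) : FiberedCat.{v', u'} 𝒮 where
  Fib X := H.Fib X × H'.Fib X
  pull f := (H.pull f).prod (H'.pull f)
  conn f g h w := NatIso.ofComponents
    (fun A => Iso.prod ((H.conn f g h w).app A.1) ((H'.conn f g h w).app A.2))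
    (fun x => Prod.ext ((H.conn f g h w).hom.naturality x.1)
      ((H'.conn f g h w).hom.naturality x.2))
  pull_id X := by rw [H.pull_id, H'.pull_id]; rfl
  conn_assoc f g h fg gh k hfg hgh h₁ h₂ A :=
    Prod.ext (H.conn_assoc f g h fg gh k hfg hgh h₁ h₂ A.1)
      (H'.conn_assoc f g h fg gh k hfg hgh h₁ h₂ A.2)

/-- The coherence condition for comparison isomorphisms that are identities; it is applied factor by
factor to permutations of products. -/
lemma FiberedCat.id_conn (H : FiberedCat.{v', u'} 𝒮) {T X V : 𝒮} (f : T ⟶ X) (g : X ⟶ V)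
    (A : H.Fib V) :
    𝟙 _ ≫ (H.conn f g (f ≫ g) rfl).hom.app A =
      (H.conn f g (f ≫ g) rfl).hom.app A ≫ 𝟙 _ ≫ (H.pull f).map (𝟙 _) := by
  simp

namespace TensorStr

variable {H : FiberedCat.{v', u'} 𝒮} (t : TensorStr H) {X : 𝒮}

@[simp]
lemma tensL_id (A B : H.Fib X) : t.tensL (𝟙 A) B = 𝟙 (t.tens A B) := by
  simp [TensorStr.tensL]

@[simp]
lemma tensR_id (A B : H.Fib X) : t.tensR A (𝟙 B) = 𝟙 (t.tens A B) :=
  ((t.tensor X).obj A).map_id B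

lemma tensL_comp {A A' A'' : H.Fib X} (x : A ⟶ A') (y : A' ⟶ A'') (B : H.Fib X) :
    t.tensL (x ≫ y) B = t.tensL x B ≫ t.tensL y B := by
  simp [TensorStr.tensL]

lemma tensR_comp (A : H.Fib X) {B B' B'' : H.Fib X} (x : B ⟶ B') (y : B' ⟶ B'') :
    t.tensR A (x ≫ y) = t.tensR A x ≫ t.tensR A y :=
  ((t.tensor X).obj A).map_comp x y

lemma tensL_tensR {A A' B B' : H.Fib X} (x : A ⟶ A') (y : B ⟶ B') :
    t.tensL x B ≫ t.tensR A' y = t.tensR A y ≫ t.tensL x B' :=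
  (((t.tensor X).map x).naturality y).symm

lemma tensL_m {T : 𝒮} (f : T ⟶ X) {A A' : H.Fib X} (x : A ⟶ A') (B : H.Fib X) :
    t.tensL ((H.pull f).map x) ((H.pull f).obj B) ≫ (t.m f A' B).hom =
      (t.m f A B).hom ≫ (H.pull f).map (t.tensL x B) :=
  t.m_natural_left f x B

lemma tensR_m {T : 𝒮} (f : T ⟶ X) (A : H.Fib X) {B B' : H.Fib X} (y : B ⟶ B') :
    t.tensR ((H.pull f).obj A) ((H.pull f).map y) ≫ (t.m f A B').hom =
      (t.m f A B).hom ≫ (H.pull f).map (t.tensR A y) :=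
  t.m_natural_right f A y

end TensorStr

namespace PseudoMor

/-- The identity. -/
def id (H : FiberedCat.{v', u'} 𝒮) : PseudoMor H H where
  F _ := 𝟭 _
  φ _ _ := Iso.refl _
  natural _ _ _ _ := by simp
  comp _ _ _ := by simp

/-- Composition. -/
def trans {H : FiberedCat.{v', u'} 𝒮} {H' : FiberedCat.{v'', u''} 𝒮} {H'' : FiberedCat 𝒮}
    (M : PseudoMor H H') (N : PseudoMor H' H'') : PseudoMor H H'' where
  F X := M.F X ⋙ N.F X
  φ {T X} f A := (N.F T).mapIso (M.φ f A) ≪≫ N.φ f ((M.F X).obj A)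
  natural f A B x := by
    have h := congrArg (N.F _).map (M.natural f x)
    simp only [Functor.map_comp] at h
    simp only [Functor.comp_map, Iso.trans_hom, Functor.mapIso_hom, Category.assoc]
    rw [reassoc_of% h, N.natural]
  comp {T X V} f g A := by
    have h := congrArg (N.F _).map (M.comp f g A)
    have h' := N.comp f g ((M.F V).obj A)
    simp only [Functor.map_comp] at h
    simp only [Functor.comp_obj, Functor.comp_map, Iso.trans_hom, Functor.mapIso_hom,
      Category.assoc, Functor.map_comp]
    rw [h', reassoc_of% h, reassoc_of% N.natural f (M.φ g A).hom]

/-- Product. -/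
def prod {H₁ H₂ : FiberedCat.{v', u'} 𝒮} {H₁' H₂' : FiberedCat.{v'', u''} 𝒮}
    (M : PseudoMor H₁ H₁') (N : PseudoMor H₂ H₂') :
    PseudoMor (H₁.prod H₂) (H₁'.prod H₂') where
  F X := (M.F X).prod (N.F X)
  φ f A := Iso.prod (M.φ f A.1) (N.φ f A.2)
  natural f _ _ x := Prod.ext (M.natural f x.1) (N.natural f x.2)
  comp f g A := Prod.ext (M.comp f g A.1) (N.comp f g A.2)

/-- The exchange of the factors of a product. -/
def swap (H₁ H₂ : FiberedCat.{v', u'} 𝒮) : PseudoMor (H₁.prod H₂) (H₂.prod H₁) where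
  F _ := CategoryTheory.Prod.swap _ _
  φ _ _ := Iso.refl _
  natural _ _ _ _ := (Category.comp_id _).trans (Category.id_comp _).symm
  comp f g A := Prod.ext (H₂.id_conn f g A.2) (H₁.id_conn f g A.1)

/-- The associativity of products. -/
def reassoc (H₁ H₂ H₃ : FiberedCat.{v', u'} 𝒮) :
    PseudoMor (H₁.prod (H₂.prod H₃)) ((H₁.prod H₂).prod H₃) where
  F _ := prod.inverseAssociator _ _ _
  φ _ _ := Iso.refl _
  natural _ _ _ _ := (Category.comp_id _).trans (Category.id_comp _).symm
  comp f g A := Prod.ext (Prod.ext (H₁.id_conn f g A.1) (H₂.id_conn f g A.2.1))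
    (H₃.id_conn f g A.2.2)

/-- The morphism `A ↦ (A, 1)` attached to a section `1`. -/
def pairRight (H : FiberedCat.{v', u'} 𝒮) {H' : FiberedCat.{v', u'} 𝒮} (one : Sect H') :
    PseudoMor H (H.prod H') where
  F X := (𝟭 _).prod' ((Functor.const _).obj (one.obj X))
  φ f _ := Iso.prod (Iso.refl _) (one.iso f).symm
  natural f _ _ _ := Prod.ext
    ((Category.comp_id _).trans (Category.id_comp _).symm)
    ((Category.id_comp _).trans ((Category.comp_id _).symm.trans
      (congrArg (fun y => _ ≫ y) ((H'.pull f).map_id _).symm)))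
  comp {T X V} f g A := Prod.ext
    (H.id_conn f g A)
    (show (one.iso (f ≫ g)).inv ≫ (H'.conn f g (f ≫ g) rfl).hom.app (one.obj V) =
      𝟙 _ ≫ (one.iso f).inv ≫ (H'.pull f).map (one.iso g).inv by
        have h := one.comp f g
        rw [Category.id_comp, Iso.inv_comp_eq, ← Category.assoc, ← Functor.mapIso_inv,
          Iso.eq_comp_inv, Functor.mapIso_hom, Iso.eq_comp_inv, Category.assoc, h,
          Iso.hom_inv_id_app_assoc])

/-- A morphism of fibered categories, with its structure isomorphisms inverted. -/
def ofMor {H₁ : FiberedCat.{v', u'} 𝒮} {H₂ : FiberedCat.{v'', u''} 𝒮} (R : Mor H₁ H₂) :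
    PseudoMor H₁ H₂ where
  F := R.R
  φ f A := ((R.θ f).app A).symm
  natural f A B x := (R.θ f).inv.naturality x
  comp {T X V} f g A := by
    have h := R.comp f g A
    simp only [Iso.symm_hom, Iso.app_inv]
    rw [← cancel_epi ((R.θ (f ≫ g)).hom.app A), Iso.hom_inv_id_app_assoc, reassoc_of% h,
      Iso.hom_inv_id_app_assoc, ← Functor.map_comp, Iso.hom_inv_id_app]
    exact ((congrArg (fun x => _ ≫ x) ((H₂.pull f).map_id _)).trans (Category.comp_id _)).symm

/-- The tensor product as a morphism of fibered categories. -/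
def tensor {H : FiberedCat.{v', u'} 𝒮} (t : TensorStr H) : PseudoMor (H.prod H) H where
  F X :=
    { obj := fun A => t.tens A.1 A.2
      map := fun {A B} x => t.tensL x.1 A.2 ≫ t.tensR B.1 x.2
      map_id := fun A => by
        change t.tensL (𝟙 A.1) A.2 ≫ t.tensR A.1 (𝟙 A.2) = _
        rw [t.tensL_id, t.tensR_id, Category.comp_id]
      map_comp := fun {A B C} x y => by
        change t.tensL (x.1 ≫ y.1) A.2 ≫ t.tensR C.1 (x.2 ≫ y.2) = _
        rw [t.tensL_comp, t.tensR_comp, Category.assoc, Category.assoc,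
          reassoc_of% t.tensL_tensR y.1 x.2] }
  φ f A := t.m f A.1 A.2
  natural f A B x := by
    change (t.tensL ((H.pull f).map x.1) _ ≫ t.tensR _ ((H.pull f).map x.2)) ≫ _ = _
    dsimp only
    rw [Category.assoc, t.m_natural_right, ← Category.assoc, t.m_natural_left]
    exact (Category.assoc _ _ _).trans
      (congrArg (fun x => _ ≫ x) ((H.pull f).map_comp _ _).symm)
  comp {T X V} f g A := (t.m_comp f g A.1 A.2).trans (Category.assoc _ _ _).symm

end PseudoMor

end Operations

/-! ### Restriction of natural isomorphisms to a full subcategory -/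

section PseudoIso

variable {𝒮 : Type u} [Category.{v} 𝒮]

/-- Restriction to a full subcategory. -/
def PseudoMor.restrict {K : FiberedCat.{v', u'} 𝒮} {L : FiberedCat.{v'', u''} 𝒮}
    (F : PseudoMor K L) (P : ObjectProperty 𝒮) : PseudoMor (K.restrict P) (L.restrict P) where
  F X := F.F X.obj
  φ f A := F.φ f.hom A
  natural f _ _ x := F.natural f.hom x
  comp f g A := F.comp f.hom g.hom A

/-- A natural isomorphism commuting with inverse images. -/
@[ext]
structure PseudoIso {K : FiberedCat.{v', u'} 𝒮} {L : FiberedCat.{v'', u''} 𝒮}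
    (F F' : PseudoMor K L) where
  iso : ∀ X : 𝒮, F.F X ≅ F'.F X
  compatible : ∀ {T X : 𝒮} (f : T ⟶ X), F.Compatible F' f (iso T).hom (iso X).hom

variable {K : FiberedCat.{v', u'} 𝒮} {L : FiberedCat.{v'', u''} 𝒮}

/-- Restriction to a full subcategory. -/
def PseudoIso.restrict {F F' : PseudoMor K L} (τ : PseudoIso F F') (P : ObjectProperty 𝒮) :
    PseudoIso (F.restrict P) (F'.restrict P) where
  iso X := τ.iso X.obj
  compatible f := τ.compatible f.hom

variable [HasFiniteProducts 𝒮] [HasInitial 𝒮] (G : Geometry 𝒮)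

/-- Compatibility with an embedding of `X` into an object of `𝒰` determines the component at `X`. -/
theorem PseudoIso.restrict_injective {F F' : PseudoMor K L}
    (hK : ∀ {Z X : 𝒮} (z : Z ⟶ X), G.cl z → IsReflection (K.pull z)) {τ τ' : PseudoIso F F'}
    (h : τ.restrict G.U = τ'.restrict G.U) : τ = τ' := by
  ext1
  funext X
  ext1
  obtain ⟨P, z, hP, hz⟩ := G.exists_embedding X
  have e : τ.iso P = τ'.iso P := congrArg (fun σ => σ.iso ⟨P, hP⟩) h
  have h' := τ'.compatible z
  rw [← e] at h'
  exact (τ.compatible z).eq (hK z hz).essSurj h'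

theorem PseudoIso.restrict_surjective {F F' : PseudoMor K L}
    (hK : ∀ {Z X : 𝒮} (z : Z ⟶ X), G.cl z → IsReflection (K.pull z))
    (τ : PseudoIso (F.restrict G.U) (F'.restrict G.U)) :
    ∃ τ' : PseudoIso F F', τ'.restrict G.U = τ := by
  obtain ⟨τ', h, h'⟩ := F.exists_extension G F' hK (fun X hX => τ.iso ⟨X, hX⟩)
    (fun {T X} hT hX f => τ.compatible
      (ObjectProperty.homMk f : (⟨T, hT⟩ : G.U.FullSubcategory) ⟶ ⟨X, hX⟩))
  exact ⟨⟨τ', h⟩, PseudoIso.ext (funext fun X => h' X.obj X.property)⟩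

end PseudoIso

/-! ### Tensor structures and constraints as natural isomorphisms -/

section MorTensor

variable {𝒮 : Type u} [Category.{v} 𝒮] {H₁ : FiberedCat.{v', u'} 𝒮} {H₂ : FiberedCat.{v'', u''} 𝒮}
  {R : Mor H₁ H₂} {t₁ : TensorStr H₁} {t₂ : TensorStr H₂}

/-- Translates between `θ`, used in `MorTensor`, and its inverse, which is the comparison
isomorphism of `PseudoMor.ofMor`. -/
lemma MorTensor.pull_comm_iff {T X : 𝒮} (f : T ⟶ X) (A B : H₁.Fib X)
    (r : t₂.tens ((R.R X).obj A) ((R.R X).obj B) ⟶ (R.R X).obj (t₁.tens A B))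
    (r' : t₂.tens ((R.R T).obj ((H₁.pull f).obj A)) ((R.R T).obj ((H₁.pull f).obj B)) ⟶
      (R.R T).obj (t₁.tens ((H₁.pull f).obj A) ((H₁.pull f).obj B))) :
    (t₂.m f ((R.R X).obj A) ((R.R X).obj B)).hom ≫ (H₂.pull f).map r ≫
        (R.θ f).hom.app (t₁.tens A B) =
      t₂.tensL ((R.θ f).hom.app A) ((H₂.pull f).obj ((R.R X).obj B)) ≫
        t₂.tensR ((R.R T).obj ((H₁.pull f).obj A)) ((R.θ f).hom.app B) ≫
        r' ≫ (R.R T).map (t₁.m f A B).hom ↔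
    ((t₂.tensL ((R.θ f).inv.app A) _ ≫ t₂.tensR _ ((R.θ f).inv.app B)) ≫
        (t₂.m f ((R.R X).obj A) ((R.R X).obj B)).hom) ≫ (H₂.pull f).map r =
      r' ≫ (R.R T).map (t₁.m f A B).hom ≫ (R.θ f).inv.app (t₁.tens A B) := by
  -- The two occurrences of `θ` on the tensor factors form one isomorphism; its inverse applies them
  -- in the opposite order, which interchange corrects.
  obtain ⟨e, he, he'⟩ : ∃ e :
      t₂.tens ((H₂.pull f).obj ((R.R X).obj A)) ((H₂.pull f).obj ((R.R X).obj B)) ≅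
      t₂.tens ((R.R T).obj ((H₁.pull f).obj A)) ((R.R T).obj ((H₁.pull f).obj B)),
      e.hom = t₂.tensL ((R.θ f).hom.app A) _ ≫ t₂.tensR _ ((R.θ f).hom.app B) ∧
      e.inv = t₂.tensL ((R.θ f).inv.app A) _ ≫ t₂.tensR _ ((R.θ f).inv.app B) :=
    ⟨((t₂.tensor T).mapIso ((R.θ f).app A)).app _ ≪≫
      ((t₂.tensor T).obj _).mapIso ((R.θ f).app B), rfl,
      (t₂.tensL_tensR ((R.θ f).inv.app A) ((R.θ f).inv.app B)).symm⟩
  erw [← he', ← Category.assoc (t₂.tensL _ _), ← he]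
  rw [← Iso.inv_comp_eq]
  rw [← Iso.app_inv (R.θ f), ← Category.assoc r', Iso.eq_comp_inv]
  simp only [Category.assoc, Iso.app_hom]

/-- `f^* R_X(A) ≅ R_T(f^* A)` -/
def Mor.pullIso (R : Mor H₁ H₂) {T X : 𝒮} (f : T ⟶ X) (A : H₁.Fib X) :
    (H₂.pull f).obj ((R.R X).obj A) ≅ (R.R T).obj ((H₁.pull f).obj A) :=
  (R.θ f).app A

lemma Mor.pullIso_naturality (R : Mor H₁ H₂) {T X : 𝒮} (f : T ⟶ X) {A B : H₁.Fib X}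
    (x : A ⟶ B) :
    (H₂.pull f).map ((R.R X).map x) ≫ (R.pullIso f B).hom =
      (R.pullIso f A).hom ≫ (R.R T).map ((H₁.pull f).map x) :=
  (R.θ f).hom.naturality x

lemma MorTensor.pull_comm_pullIso (ρ : MorTensor R t₁ t₂) {T X : 𝒮} (f : T ⟶ X)
    (A B : H₁.Fib X) :
    (t₂.m f ((R.R X).obj A) ((R.R X).obj B)).hom ≫ (H₂.pull f).map (ρ.ρ A B).hom ≫
        (R.pullIso f (t₁.tens A B)).hom =
      t₂.tensL (R.pullIso f A).hom ((H₂.pull f).obj ((R.R X).obj B)) ≫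
        t₂.tensR ((R.R T).obj ((H₁.pull f).obj A)) (R.pullIso f B).hom ≫
        (ρ.ρ ((H₁.pull f).obj A) ((H₁.pull f).obj B)).hom ≫ (R.R T).map (t₁.m f A B).hom :=
  ρ.pull_comm f A B

variable (R t₁ t₂) in
/-- `(A, B) ↦ R(A) ⊗ R(B)` -/
abbrev MorTensor.source : PseudoMor (H₁.prod H₁) H₂ :=
  ((PseudoMor.ofMor R).prod (PseudoMor.ofMor R)).trans (PseudoMor.tensor t₂)

variable (R t₁ t₂) in
/-- `(A, B) ↦ R(A ⊗ B)` -/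
abbrev MorTensor.target : PseudoMor (H₁.prod H₁) H₂ :=
  (PseudoMor.tensor t₁).trans (PseudoMor.ofMor R)

/-- A tensor structure on a morphism as a natural isomorphism in two variables. -/
def MorTensor.toPseudoIso (ρ : MorTensor R t₁ t₂) :
    PseudoIso (MorTensor.source R t₂) (MorTensor.target R t₁) where
  iso X := NatIso.ofComponents (fun A => ρ.ρ A.1 A.2) (fun {A B} x => by
    change (t₂.tensL ((R.R X).map x.1) _ ≫ t₂.tensR _ ((R.R X).map x.2)) ≫ (ρ.ρ B.1 B.2).hom =
      (ρ.ρ A.1 A.2).hom ≫ (R.R X).map (t₁.tensL x.1 A.2 ≫ t₁.tensR B.1 x.2)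
    rw [Category.assoc, ρ.natural_right, ← Category.assoc, ρ.natural_left, Functor.map_comp,
      Category.assoc])
  compatible f A := (MorTensor.pull_comm_iff f A.1 A.2 _ _).1 (ρ.pull_comm f A.1 A.2)

/-- The inverse of `MorTensor.toPseudoIso`. -/
def MorTensor.ofPseudoIso
    (τ : PseudoIso (MorTensor.source R t₂) (MorTensor.target R t₁)) : MorTensor R t₁ t₂ where
  ρ {X} A B := (τ.iso X).app (A, B)
  natural_left {X A A'} x B := by
    have h := (τ.iso X).hom.naturality (X := (A, B)) (Y := (A', B)) (x, 𝟙 B)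
    change (t₂.tensL ((R.R X).map x) _ ≫ t₂.tensR _ ((R.R X).map (𝟙 B))) ≫ _ =
      _ ≫ (R.R X).map (t₁.tensL x B ≫ t₁.tensR A' (𝟙 B)) at h
    rwa [CategoryTheory.Functor.map_id, t₁.tensR_id, t₂.tensR_id, Category.comp_id,
    Category.comp_id] at h
  natural_right {X} A {B B'} y := by
    have h := (τ.iso X).hom.naturality (X := (A, B)) (Y := (A, B')) (𝟙 A, y)
    change (t₂.tensL ((R.R X).map (𝟙 A)) _ ≫ t₂.tensR _ ((R.R X).map y)) ≫ _ =
      _ ≫ (R.R X).map (t₁.tensL (𝟙 A) B ≫ t₁.tensR A y) at h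
    rwa [CategoryTheory.Functor.map_id, t₁.tensL_id, t₂.tensL_id, Category.id_comp,
    Category.id_comp] at h
  pull_comm f A B := (MorTensor.pull_comm_iff f A B _ _).2 (τ.compatible f (A, B))

lemma MorTensor.toPseudoIso_injective :
    Function.Injective (MorTensor.toPseudoIso : MorTensor R t₁ t₂ → _) := by
  intro ρ ρ' h
  ext X A B : 4
  exact congrArg (fun τ => (τ.iso X).app (A, B)) h

end MorTensor

/-! ### Associativity, commutativity and unit constraints -/

section Constraints

variable {𝒮 : Type u} [Category.{v} 𝒮] {H : FiberedCat.{v', u'} 𝒮} {t : TensorStr H}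

lemma PseudoMor.swap_trans_φ {H' : FiberedCat.{v', u'} 𝒮} {L : FiberedCat.{v'', u''} 𝒮}
    (N : PseudoMor (H'.prod H) L) {T X : 𝒮} (f : T ⟶ X) (A : H.Fib X) (B : H'.Fib X) :
    (((PseudoMor.swap H H').trans N).φ f (A, B)).hom = (N.φ f (B, A)).hom :=
  (congrArg (fun x => x ≫ (N.φ f (B, A)).hom) ((N.F T).map_id _)).trans (Category.id_comp _)

variable (t) in
/-- `(A, B, C) ↦ (A ⊗ B) ⊗ C` -/
abbrev TensorStr.tensor₃Left : PseudoMor (H.prod (H.prod H)) H :=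
  (PseudoMor.reassoc H H H).trans
    (((PseudoMor.tensor t).prod (PseudoMor.id H)).trans (PseudoMor.tensor t))

variable (t) in
/-- `(A, B, C) ↦ A ⊗ (B ⊗ C)` -/
abbrev TensorStr.tensor₃Right : PseudoMor (H.prod (H.prod H)) H :=
  ((PseudoMor.id H).prod (PseudoMor.tensor t)).trans (PseudoMor.tensor t)

lemma TensorStr.tensor₃Left_map {X : 𝒮} {A A' B B' C C' : H.Fib X} (x : A ⟶ A') (y : B ⟶ B')
    (z : C ⟶ C') :
    (t.tensor₃Left.F X).map (X := (A, B, C)) (Y := (A', B', C')) (x, y, z) =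
      (t.tensL (t.tensL x B) C ≫ t.tensL (t.tensR A' y) C) ≫ t.tensR (t.tens A' B') z :=
  congrArg (fun w => w ≫ t.tensR (t.tens A' B') z) (t.tensL_comp (t.tensL x B) (t.tensR A' y) C)

lemma TensorStr.tensor₃Right_map {X : 𝒮} {A A' B B' C C' : H.Fib X} (x : A ⟶ A') (y : B ⟶ B')
    (z : C ⟶ C') :
    (t.tensor₃Right.F X).map (X := (A, B, C)) (Y := (A', B', C')) (x, y, z) =
      t.tensL x (t.tens B C) ≫ t.tensR A' (t.tensL y C) ≫ t.tensR A' (t.tensR B' z) :=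
  congrArg (fun w => t.tensL x (t.tens B C) ≫ w) (t.tensR_comp A' (t.tensL y C) (t.tensR B' z))

lemma TensorStr.tensor₃Left_φ {T X : 𝒮} (f : T ⟶ X) (A B C : H.Fib X) :
    (t.tensor₃Left.φ f (A, B, C)).hom =
      t.tensL (t.m f A B).hom ((H.pull f).obj C) ≫ (t.m f (t.tens A B) C).hom := by
  refine (congrArg (fun x => x ≫ ((((PseudoMor.tensor t).prod (PseudoMor.id H)).trans
    (PseudoMor.tensor t)).φ f ((A, B), C)).hom) (CategoryTheory.Functor.map_id _ _)).trans
    ((Category.id_comp _).trans ?_)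
  refine congrArg (fun x => x ≫ (t.m f (t.tens A B) C).hom) ?_
  exact (congrArg (fun x => t.tensL (t.m f A B).hom _ ≫ x) (t.tensR_id _ _)).trans
    (Category.comp_id _)

lemma TensorStr.tensor₃Right_φ {T X : 𝒮} (f : T ⟶ X) (A B C : H.Fib X) :
    (t.tensor₃Right.φ f (A, B, C)).hom =
      t.tensR ((H.pull f).obj A) (t.m f B C).hom ≫ (t.m f A (t.tens B C)).hom := by
  refine congrArg (fun x => x ≫ (t.m f A (t.tens B C)).hom) ?_
  exact (congrArg (fun x => x ≫ t.tensR _ (t.m f B C).hom) (t.tensL_id _ _)).trans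
    (Category.id_comp _)

/-- An associativity constraint as a natural isomorphism in three variables. -/
def AssocConstraint.toPseudoIso (a : AssocConstraint t) :
    PseudoIso t.tensor₃Left t.tensor₃Right where
  iso X := NatIso.ofComponents (fun A => a.a A.1 A.2.1 A.2.2) (fun {A B} x => by
    rw [show x = (x.1, x.2.1, x.2.2) from rfl]
    refine (congrArg (fun w => w ≫ _) (t.tensor₃Left_map _ _ _)).trans
      (.trans ?_ (congrArg (fun w => _ ≫ w) (t.tensor₃Right_map _ _ _).symm))
    change _ ≫ (a.a B.1 B.2.1 B.2.2).hom = (a.a A.1 A.2.1 A.2.2).hom ≫ _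
    rw [Category.assoc, a.natural₃, Category.assoc, ← Category.assoc (t.tensL _ _) (a.a _ _ _).hom,
      a.natural₂, Category.assoc, ← Category.assoc, a.natural₁, Category.assoc]
    rfl)
  compatible f A := by
    refine (congrArg (fun w => w ≫ _) (t.tensor₃Left_φ f A.1 A.2.1 A.2.2)).trans
      (.trans ?_ (congrArg (fun w => _ ≫ w) (t.tensor₃Right_φ f A.1 A.2.1 A.2.2).symm))
    exact (Category.assoc _ _ _).trans (a.pull_comm f A.1 A.2.1 A.2.2)

lemma AssocConstraint.toPseudoIso_injective :
    Function.Injective (AssocConstraint.toPseudoIso : AssocConstraint t → _) := by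
  intro a a' h
  ext X A B C : 5
  exact congrArg (fun τ => (τ.iso X).app (A, B, C)) h

/-- The pentagon identity descends along an essentially surjective inverse image. -/
theorem TensorStr.pentagon_of_pull {T X : 𝒮} (f : T ⟶ X) (hf : (H.pull f).EssSurj)
    (a : ∀ A B C : H.Fib T, t.tens (t.tens A B) C ≅ t.tens A (t.tens B C))
    (n₁ : ∀ {A A' : H.Fib T} (x : A ⟶ A') (B C : H.Fib T),
      t.tensL (t.tensL x B) C ≫ (a A' B C).hom = (a A B C).hom ≫ t.tensL x (t.tens B C))
    (n₂ : ∀ (A : H.Fib T) {B B' : H.Fib T} (y : B ⟶ B') (C : H.Fib T),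
      t.tensL (t.tensR A y) C ≫ (a A B' C).hom = (a A B C).hom ≫ t.tensR A (t.tensL y C))
    (n₃ : ∀ (A B : H.Fib T) {C C' : H.Fib T} (z : C ⟶ C'),
      t.tensR (t.tens A B) z ≫ (a A B C').hom = (a A B C).hom ≫ t.tensR A (t.tensR B z))
    (a' : ∀ A B C : H.Fib X, t.tens (t.tens A B) C ≅ t.tens A (t.tens B C))
    (pc : ∀ A B C : H.Fib X,
      t.tensL (t.m f A B).hom ((H.pull f).obj C) ≫ (t.m f (t.tens A B) C).hom ≫
          (H.pull f).map (a' A B C).hom =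
        (a ((H.pull f).obj A) ((H.pull f).obj B) ((H.pull f).obj C)).hom ≫
          t.tensR ((H.pull f).obj A) (t.m f B C).hom ≫ (t.m f A (t.tens B C)).hom)
    (h : ∀ A B C D, (a' (t.tens A B) C D).hom ≫ (a' A B (t.tens C D)).hom =
      t.tensL (a' A B C).hom D ≫ (a' A (t.tens B C) D).hom ≫ t.tensR A (a' B C D).hom)
    (A B C D : H.Fib T) :
    (a (t.tens A B) C D).hom ≫ (a A B (t.tens C D)).hom =
      t.tensL (a A B C).hom D ≫ (a A (t.tens B C) D).hom ≫ t.tensR A (a B C D).hom := by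
  -- Each object is isomorphic to a pulled-back one. In each of the next four rewrites, naturality
  -- carries one of the `eᵢ` from the front of both sides to the end, where it cancels.
  obtain ⟨A', ⟨e₁⟩⟩ := hf.mem_essImage A
  obtain ⟨B', ⟨e₂⟩⟩ := hf.mem_essImage B
  obtain ⟨C', ⟨e₃⟩⟩ := hf.mem_essImage C
  obtain ⟨D', ⟨e₄⟩⟩ := hf.mem_essImage D
  rw [← cancel_epi (t.tensL (t.tensL (t.tensL e₁.hom B) C) D), reassoc_of% n₁, n₁,
    ← reassoc_of% t.tensL_comp, n₁, t.tensL_comp, Category.assoc, reassoc_of% n₁,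
    t.tensL_tensR, ← Category.assoc, ← Category.assoc, ← Category.assoc, cancel_mono,
    Category.assoc]
  rw [← cancel_epi (t.tensL (t.tensL (t.tensR _ e₂.hom) C) D), reassoc_of% n₁, n₂,
    ← reassoc_of% t.tensL_comp, n₂, t.tensL_comp, Category.assoc, reassoc_of% n₂,
    ← t.tensR_comp, n₁, t.tensR_comp, ← Category.assoc, ← Category.assoc, ← Category.assoc,
    cancel_mono, Category.assoc]
  rw [← cancel_epi (t.tensL (t.tensR _ e₃.hom) D), reassoc_of% n₂, n₃,
    ← reassoc_of% t.tensL_comp, n₃, t.tensL_comp, Category.assoc, reassoc_of% n₂,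
    ← t.tensR_comp, n₂, t.tensR_comp, ← Category.assoc, ← Category.assoc, ← Category.assoc,
    cancel_mono, Category.assoc]
  rw [← cancel_epi (t.tensR _ e₄.hom), reassoc_of% n₃, n₃,
    ← reassoc_of% t.tensL_tensR, reassoc_of% n₃,
    ← t.tensR_comp, n₃, t.tensR_comp, ← Category.assoc, ← Category.assoc, ← Category.assoc,
    cancel_mono, Category.assoc]
  -- Appending the comparison of the fourfold product with its pullback reduces the identity to
  -- `f^*` of the pentagon over `X`.
  rw [← cancel_mono (t.tensR _ (t.tensR _ (t.m f C' D').hom) ≫ t.tensR _ (t.m f B' _).hom ≫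
    (t.m f A' _).hom)]
  have p₁ := congrArg (fun x => t.tensL x ((H.pull f).obj D')) (pc A' B' C')
  have p₂ := congrArg (fun x => t.tensR ((H.pull f).obj A') x) (pc B' C' D')
  have h' := congrArg (H.pull f).map (h A' B' C' D')
  simp only [t.tensL_comp, t.tensR_comp, Functor.map_comp] at p₁ p₂ h'
  simp only [Category.assoc]
  rw [← reassoc_of% n₃, ← pc, ← reassoc_of% t.tensL_tensR, ← reassoc_of% n₁, ← reassoc_of% pc, h',
    ← reassoc_of% p₂, t.tensR_m, ← reassoc_of% n₂, ← reassoc_of% pc, ← reassoc_of% p₁,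
    reassoc_of% t.tensL_m]

section

variable (τ : PseudoIso t.tensor₃Left t.tensor₃Right)

/-- The component at `(A, B, C)`. -/
def PseudoIso.app₃ {X : 𝒮} (A B C : H.Fib X) : t.tens (t.tens A B) C ≅ t.tens A (t.tens B C) :=
  (τ.iso X).app (A, B, C)

lemma PseudoIso.app₃_natural₁ {X : 𝒮} {A A' : H.Fib X} (x : A ⟶ A') (B C : H.Fib X) :
    t.tensL (t.tensL x B) C ≫ (τ.app₃ A' B C).hom =
      (τ.app₃ A B C).hom ≫ t.tensL x (t.tens B C) := by
  have h := (τ.iso X).hom.naturality (X := (A, B, C)) (Y := (A', B, C)) (x, 𝟙 B, 𝟙 C)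
  rw [t.tensor₃Left_map, t.tensor₃Right_map] at h
  simp only [TensorStr.tensL_id, TensorStr.tensR_id, Category.comp_id] at h
  exact h

lemma PseudoIso.app₃_natural₂ {X : 𝒮} (A : H.Fib X) {B B' : H.Fib X} (y : B ⟶ B')
    (C : H.Fib X) :
    t.tensL (t.tensR A y) C ≫ (τ.app₃ A B' C).hom =
      (τ.app₃ A B C).hom ≫ t.tensR A (t.tensL y C) := by
  have h := (τ.iso X).hom.naturality (X := (A, B, C)) (Y := (A, B', C)) (𝟙 A, y, 𝟙 C)
  rw [t.tensor₃Left_map, t.tensor₃Right_map] at h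
  simp only [TensorStr.tensL_id, TensorStr.tensR_id, Category.id_comp, Category.comp_id] at h
  exact h

lemma PseudoIso.app₃_natural₃ {X : 𝒮} (A B : H.Fib X) {C C' : H.Fib X} (z : C ⟶ C') :
    t.tensR (t.tens A B) z ≫ (τ.app₃ A B C').hom =
      (τ.app₃ A B C).hom ≫ t.tensR A (t.tensR B z) := by
  have h := (τ.iso X).hom.naturality (X := (A, B, C)) (Y := (A, B, C')) (𝟙 A, 𝟙 B, z)
  rw [t.tensor₃Left_map, t.tensor₃Right_map] at h
  simp only [TensorStr.tensL_id, TensorStr.tensR_id, Category.id_comp] at h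
  exact h

lemma PseudoIso.app₃_pull_comm {T X : 𝒮} (f : T ⟶ X) (A B C : H.Fib X) :
    t.tensL (t.m f A B).hom ((H.pull f).obj C) ≫ (t.m f (t.tens A B) C).hom ≫
        (H.pull f).map (τ.app₃ A B C).hom =
      (τ.app₃ ((H.pull f).obj A) ((H.pull f).obj B) ((H.pull f).obj C)).hom ≫
        t.tensR ((H.pull f).obj A) (t.m f B C).hom ≫ (t.m f A (t.tens B C)).hom := by
  have h := τ.compatible f (A, B, C)
  rw [t.tensor₃Left_φ, t.tensor₃Right_φ] at h
  exact (Category.assoc _ _ _).symm.trans h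

end

/-- A natural isomorphism in three variables which satisfies the pentagon identity is an
associativity constraint. -/
def AssocConstraint.ofPseudoIso (τ : PseudoIso t.tensor₃Left t.tensor₃Right)
    (h : ∀ {T : 𝒮}, ∃ (X : 𝒮) (f : T ⟶ X)
      (a : ∀ A B C : H.Fib X, t.tens (t.tens A B) C ≅ t.tens A (t.tens B C)),
      (H.pull f).EssSurj ∧ (∀ A B C, a A B C = (τ.iso X).app (A, B, C)) ∧ ∀ A B C D,
        (a (t.tens A B) C D).hom ≫ (a A B (t.tens C D)).hom =
          t.tensL (a A B C).hom D ≫ (a A (t.tens B C) D).hom ≫ t.tensR A (a B C D).hom) :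
    AssocConstraint t where
  a := τ.app₃
  natural₁ := τ.app₃_natural₁
  natural₂ := τ.app₃_natural₂
  natural₃ := τ.app₃_natural₃
  pentagon {T} A B C D := by
    -- The family `a` is kept apart from `τ` because in the application it is the given constraint
    -- over `𝒰`, whose pentagon is known and which `τ` extends.
    obtain ⟨X, f, a, hf, ha, ha'⟩ := h (T := T)
    refine TensorStr.pentagon_of_pull f hf τ.app₃ τ.app₃_natural₁ τ.app₃_natural₂
      τ.app₃_natural₃ a (fun A B C => ?_) ha' A B C D
    rw [ha]
    exact τ.app₃_pull_comm f A B C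
  pull_comm := τ.app₃_pull_comm

/-! ### Commutativity constraints -/

/-- A commutativity constraint as a natural isomorphism in two variables. -/
def CommConstraint.toPseudoIso (c : CommConstraint t) :
    PseudoIso (PseudoMor.tensor t) ((PseudoMor.swap H H).trans (PseudoMor.tensor t)) where
  iso X := NatIso.ofComponents (fun A => c.c A.1 A.2) (fun {A B} x => by
    change (t.tensL x.1 A.2 ≫ t.tensR B.1 x.2) ≫ (c.c B.1 B.2).hom =
      (c.c A.1 A.2).hom ≫ t.tensL x.2 A.1 ≫ t.tensR B.2 x.1
    rw [t.tensL_tensR, Category.assoc, c.natural_left, ← Category.assoc, c.natural_right,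
      Category.assoc])
  compatible f A := (c.pull_comm f A.1 A.2).trans
    (congrArg (fun x => _ ≫ x)
      (PseudoMor.swap_trans_φ (PseudoMor.tensor t) f A.1 A.2).symm)

lemma CommConstraint.toPseudoIso_injective :
    Function.Injective (CommConstraint.toPseudoIso : CommConstraint t → _) := by
  intro c c' h
  ext X A B : 4
  ext1
  exact congrArg (fun τ => ((τ.iso X).app (A, B)).hom) h

/-- The symmetry of a commutativity constraint descends along an essentially surjective inverse
image. -/
theorem TensorStr.symm_of_pull {T X : 𝒮} (f : T ⟶ X) (hf : (H.pull f).EssSurj)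
    (c : ∀ A B : H.Fib T, t.tens A B ≅ t.tens B A)
    (n₁ : ∀ {A A' : H.Fib T} (x : A ⟶ A') (B : H.Fib T),
      t.tensL x B ≫ (c A' B).hom = (c A B).hom ≫ t.tensR B x)
    (n₂ : ∀ (A : H.Fib T) {B B' : H.Fib T} (y : B ⟶ B'),
      t.tensR A y ≫ (c A B').hom = (c A B).hom ≫ t.tensL y A)
    (c' : ∀ A B : H.Fib X, t.tens A B ≅ t.tens B A)
    (pc : ∀ A B : H.Fib X, (t.m f A B).hom ≫ (H.pull f).map (c' A B).hom =
      (c ((H.pull f).obj A) ((H.pull f).obj B)).hom ≫ (t.m f B A).hom)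
    (h : ∀ A B : H.Fib X, (c' A B).hom ≫ (c' B A).hom = 𝟙 (t.tens A B)) (A B : H.Fib T) :
    (c A B).hom ≫ (c B A).hom = 𝟙 (t.tens A B) := by
  obtain ⟨A', ⟨e₁⟩⟩ := hf.mem_essImage A
  obtain ⟨B', ⟨e₂⟩⟩ := hf.mem_essImage B
  rw [← cancel_epi (t.tensL e₁.hom B), reassoc_of% n₁, n₂, ← Category.assoc]
  refine (Eq.trans ?_ (Category.id_comp _)).trans (Category.comp_id _).symm
  congr 1
  rw [← cancel_epi (t.tensR _ e₂.hom), reassoc_of% n₂, n₁, ← Category.assoc]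
  refine (Eq.trans ?_ (Category.id_comp _)).trans (Category.comp_id _).symm
  congr 1
  rw [← cancel_mono (t.m f A' B').hom, Category.assoc, ← pc, ← reassoc_of% pc, ← Functor.map_comp,
    h, CategoryTheory.Functor.map_id, Category.comp_id, Category.id_comp]

section

variable (τ : PseudoIso (PseudoMor.tensor t) ((PseudoMor.swap H H).trans (PseudoMor.tensor t)))

/-- The component at `(A, B)`. -/
def PseudoIso.app₂ {X : 𝒮} (A B : H.Fib X) : t.tens A B ≅ t.tens B A :=
  (τ.iso X).app (A, B)

lemma PseudoIso.app₂_natural_left {X : 𝒮} {A A' : H.Fib X} (x : A ⟶ A') (B : H.Fib X) :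
    t.tensL x B ≫ (τ.app₂ A' B).hom = (τ.app₂ A B).hom ≫ t.tensR B x := by
  have h := (τ.iso X).hom.naturality (X := (A, B)) (Y := (A', B)) (x, 𝟙 B)
  change (t.tensL x B ≫ t.tensR A' (𝟙 B)) ≫ _ = _ ≫ t.tensL (𝟙 B) A ≫ t.tensR B x at h
  rwa [t.tensR_id, t.tensL_id, Category.comp_id, Category.id_comp] at h

lemma PseudoIso.app₂_natural_right {X : 𝒮} (A : H.Fib X) {B B' : H.Fib X} (y : B ⟶ B') :
    t.tensR A y ≫ (τ.app₂ A B').hom = (τ.app₂ A B).hom ≫ t.tensL y A := by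
  have h := (τ.iso X).hom.naturality (X := (A, B)) (Y := (A, B')) (𝟙 A, y)
  change (t.tensL (𝟙 A) B ≫ t.tensR A y) ≫ _ = _ ≫ t.tensL y A ≫ t.tensR B' (𝟙 A) at h
  rwa [t.tensR_id, t.tensL_id, Category.comp_id, Category.id_comp] at h

lemma PseudoIso.app₂_pull_comm {T X : 𝒮} (f : T ⟶ X) (A B : H.Fib X) :
    (t.m f A B).hom ≫ (H.pull f).map (τ.app₂ A B).hom =
      (τ.app₂ ((H.pull f).obj A) ((H.pull f).obj B)).hom ≫ (t.m f B A).hom :=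
  (τ.compatible f (A, B)).trans (congrArg (fun x => _ ≫ x) (PseudoMor.swap_trans_φ _ f A B))

end

/-- A natural isomorphism in two variables which is symmetric is a commutativity constraint. -/
def CommConstraint.ofPseudoIso
    (τ : PseudoIso (PseudoMor.tensor t) ((PseudoMor.swap H H).trans (PseudoMor.tensor t)))
    (h : ∀ {T : 𝒮}, ∃ (X : 𝒮) (f : T ⟶ X) (c : ∀ A B : H.Fib X, t.tens A B ≅ t.tens B A),
      (H.pull f).EssSurj ∧ (∀ A B, c A B = (τ.iso X).app (A, B)) ∧
        ∀ A B, (c A B).hom ≫ (c B A).hom = 𝟙 (t.tens A B)) :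
    CommConstraint t where
  c := τ.app₂
  natural_left := τ.app₂_natural_left
  natural_right := τ.app₂_natural_right
  symm {T} A B := by
    obtain ⟨X, f, c, hf, hc, hc'⟩ := h (T := T)
    refine TensorStr.symm_of_pull f hf τ.app₂ τ.app₂_natural_left τ.app₂_natural_right c
      (fun A B => ?_) hc' A B
    rw [hc]
    exact τ.app₂_pull_comm f A B
  pull_comm := τ.app₂_pull_comm

/-! ### Unit constraints -/

variable {one : Sect H}

variable (t one) in
/-- `A ↦ A ⊗ 1` -/
abbrev TensorStr.tensorOne : PseudoMor H H :=
  (PseudoMor.pairRight H one).trans (PseudoMor.tensor t)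

variable (t one) in
/-- `A ↦ 1 ⊗ A` -/
abbrev TensorStr.oneTensor : PseudoMor H H :=
  (PseudoMor.pairRight H one).trans ((PseudoMor.swap H H).trans (PseudoMor.tensor t))

lemma TensorStr.tensorOne_φ {T X : 𝒮} (f : T ⟶ X) (A : H.Fib X) :
    ((t.tensorOne one).φ f A).hom =
      t.tensR ((H.pull f).obj A) (one.iso f).inv ≫ (t.m f A (one.obj X)).hom :=
  congrArg (fun x => x ≫ (t.m f A (one.obj X)).hom)
    ((congrArg (fun x => x ≫ t.tensR ((H.pull f).obj A) (one.iso f).inv) (t.tensL_id _ _)).trans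
      (Category.id_comp _))

lemma TensorStr.oneTensor_φ {T X : 𝒮} (f : T ⟶ X) (A : H.Fib X) :
    ((t.oneTensor one).φ f A).hom =
      t.tensL (one.iso f).inv ((H.pull f).obj A) ≫ (t.m f (one.obj X) A).hom := by
  have h := PseudoMor.swap_trans_φ (PseudoMor.tensor t) f A (one.obj X)
  refine (congrArg (fun x => (((PseudoMor.swap H H).trans (PseudoMor.tensor t)).F T).map
    (((PseudoMor.pairRight H one).φ f A).hom) ≫ x) h).trans
    (congrArg (fun x => x ≫ (t.m f (one.obj X) A).hom) ?_)
  exact (congrArg (fun x => t.tensL (one.iso f).inv ((H.pull f).obj A) ≫ x)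
    (t.tensR_id _ _)).trans (Category.comp_id _)

lemma TensorStr.tensorOne_map {X : 𝒮} {A A' : H.Fib X} (x : A ⟶ A') :
    ((t.tensorOne one).F X).map x = t.tensL x (one.obj X) :=
  (congrArg (fun y => t.tensL x (one.obj X) ≫ y) (t.tensR_id _ _)).trans (Category.comp_id _)

lemma TensorStr.oneTensor_map {X : 𝒮} {A A' : H.Fib X} (x : A ⟶ A') :
    ((t.oneTensor one).F X).map x = t.tensR (one.obj X) x :=
  (congrArg (fun y => y ≫ t.tensR (one.obj X) x) (t.tensL_id _ _)).trans (Category.id_comp _)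

/-- The section's structure map enters `PseudoMor.pairRight` inverted, as `1_T ≅ f^* 1_X`; this
moves it to the other side. -/
lemma UnitConstraint.pull_r_iff {T X : 𝒮} (f : T ⟶ X) (A : H.Fib X)
    (r : t.tens A (one.obj X) ⟶ A)
    (r' : t.tens ((H.pull f).obj A) (one.obj T) ⟶ (H.pull f).obj A) :
    t.tensR ((H.pull f).obj A) (one.iso f).hom ≫ r' =
        (t.m f A (one.obj X)).hom ≫ (H.pull f).map r ↔
      (t.tensR ((H.pull f).obj A) (one.iso f).inv ≫ (t.m f A (one.obj X)).hom) ≫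
        (H.pull f).map r = r' := by
  have h := Iso.inv_comp_eq (((t.tensor T).obj ((H.pull f).obj A)).mapIso (one.iso f))
    (f := (t.m f A (one.obj X)).hom ≫ (H.pull f).map r) (g := r')
  rw [Functor.mapIso_inv, Functor.mapIso_hom] at h
  rw [Category.assoc, h]
  exact eq_comm

lemma UnitConstraint.pull_l_iff {T X : 𝒮} (f : T ⟶ X) (A : H.Fib X)
    (l : t.tens (one.obj X) A ⟶ A)
    (l' : t.tens (one.obj T) ((H.pull f).obj A) ⟶ (H.pull f).obj A) :
    t.tensL (one.iso f).hom ((H.pull f).obj A) ≫ l' =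
        (t.m f (one.obj X) A).hom ≫ (H.pull f).map l ↔
      (t.tensL (one.iso f).inv ((H.pull f).obj A) ≫ (t.m f (one.obj X) A).hom) ≫
        (H.pull f).map l = l' := by
  have h := Iso.inv_comp_eq (((t.tensor T).mapIso (one.iso f)).app ((H.pull f).obj A))
    (f := (t.m f (one.obj X) A).hom ≫ (H.pull f).map l) (g := l')
  rw [Iso.app_inv, Iso.app_hom, Functor.mapIso_inv, Functor.mapIso_hom] at h
  rw [Category.assoc, h]
  exact eq_comm

/-- A right unit constraint as a natural isomorphism. -/
def UnitConstraint.rightPseudoIso (e : UnitConstraint t one) :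
    PseudoIso (t.tensorOne one) (PseudoMor.id H) where
  iso X := NatIso.ofComponents (fun A => e.r A) (fun {A B} x => by
    rw [t.tensorOne_map]
    exact e.r_natural x)
  compatible {T X} f A := by
    rw [t.tensorOne_φ]
    exact ((UnitConstraint.pull_r_iff f A _ _).1 (e.pull_r f A)).trans (Category.comp_id _).symm

/-- A left unit constraint as a natural isomorphism. -/
def UnitConstraint.leftPseudoIso (e : UnitConstraint t one) :
    PseudoIso (t.oneTensor one) (PseudoMor.id H) where
  iso X := NatIso.ofComponents (fun A => e.l A) (fun {A B} x => by
    rw [t.oneTensor_map]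
    exact e.l_natural x)
  compatible {T X} f A := by
    rw [t.oneTensor_φ]
    exact ((UnitConstraint.pull_l_iff f A _ _).1 (e.pull_l f A)).trans (Category.comp_id _).symm

lemma UnitConstraint.eq_of_pseudoIso {e e' : UnitConstraint t one}
    (h : e.rightPseudoIso = e'.rightPseudoIso) (h' : e.leftPseudoIso = e'.leftPseudoIso) :
    e = e' := by
  ext X A : 3
  · ext1
    exact congrArg (fun τ => ((τ.iso X).app A).hom) h
  · ext1
    exact congrArg (fun τ => ((τ.iso X).app A).hom) h'

section

variable (ρ : PseudoIso (t.tensorOne one) (PseudoMor.id H))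
  (l : PseudoIso (t.oneTensor one) (PseudoMor.id H))

/-- The component `A ⊗ 1 ≅ A`. -/
def PseudoIso.appRight {X : 𝒮} (A : H.Fib X) : t.tens A (one.obj X) ≅ A :=
  (ρ.iso X).app A

/-- The component `1 ⊗ A ≅ A`. -/
def PseudoIso.appLeft {X : 𝒮} (A : H.Fib X) : t.tens (one.obj X) A ≅ A :=
  (l.iso X).app A

lemma PseudoIso.appRight_natural {X : 𝒮} {A A' : H.Fib X} (x : A ⟶ A') :
    t.tensL x (one.obj X) ≫ (ρ.appRight A').hom = (ρ.appRight A).hom ≫ x := by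
  have h := (ρ.iso X).hom.naturality x
  rw [t.tensorOne_map] at h
  exact h

lemma PseudoIso.appLeft_natural {X : 𝒮} {A A' : H.Fib X} (x : A ⟶ A') :
    t.tensR (one.obj X) x ≫ (l.appLeft A').hom = (l.appLeft A).hom ≫ x := by
  have h := (l.iso X).hom.naturality x
  rw [t.oneTensor_map] at h
  exact h

lemma PseudoIso.appRight_pull {T X : 𝒮} (f : T ⟶ X) (A : H.Fib X) :
    t.tensR ((H.pull f).obj A) (one.iso f).hom ≫ (ρ.appRight ((H.pull f).obj A)).hom =
      (t.m f A (one.obj X)).hom ≫ (H.pull f).map (ρ.appRight A).hom :=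
  (UnitConstraint.pull_r_iff f A _ _).2 (by
    have h := ρ.compatible f A
    rw [t.tensorOne_φ] at h
    exact h.trans (Category.comp_id _))

lemma PseudoIso.appLeft_pull {T X : 𝒮} (f : T ⟶ X) (A : H.Fib X) :
    t.tensL (one.iso f).hom ((H.pull f).obj A) ≫ (l.appLeft ((H.pull f).obj A)).hom =
      (t.m f (one.obj X) A).hom ≫ (H.pull f).map (l.appLeft A).hom :=
  (UnitConstraint.pull_l_iff f A _ _).2 (by
    have h := l.compatible f A
    rw [t.oneTensor_φ] at h
    exact h.trans (Category.comp_id _))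

/-- Here `f` need not have an essentially surjective inverse image: the object concerned is `1_T`,
which is `f^* 1_X` by the section structure. -/
lemma PseudoIso.appRight_one_eq_appLeft_one {T X : 𝒮} (f : T ⟶ X)
    (h : (ρ.appRight (one.obj X)).hom = (l.appLeft (one.obj X)).hom) :
    (ρ.appRight (one.obj T)).hom = (l.appLeft (one.obj T)).hom := by
  rw [← cancel_epi (t.tensL (one.iso f).hom _), ← cancel_epi (t.tensR _ (one.iso f).hom),
    ρ.appRight_natural, reassoc_of% ρ.appRight_pull, h, ← reassoc_of% t.tensL_tensR,
    l.appLeft_natural,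
    reassoc_of% l.appLeft_pull]

end

/-- Natural isomorphisms `A ⊗ 1 ≅ A` and `1 ⊗ A ≅ A` which agree on `1 ⊗ 1` form a unit
constraint. -/
def UnitConstraint.ofPseudoIso (ρ : PseudoIso (t.tensorOne one) (PseudoMor.id H))
    (l : PseudoIso (t.oneTensor one) (PseudoMor.id H))
    (h : ∀ {T : 𝒮}, ∃ (X : 𝒮) (_ : T ⟶ X),
      (ρ.appRight (one.obj X)).hom = (l.appLeft (one.obj X)).hom) :
    UnitConstraint t one where
  r := ρ.appRight
  l := l.appLeft
  r_natural := ρ.appRight_natural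
  l_natural := l.appLeft_natural
  r_one_eq_l_one T := by
    obtain ⟨X, f, hX⟩ := h (T := T)
    exact ρ.appRight_one_eq_appLeft_one l f hX
  pull_r := ρ.appRight_pull
  pull_l := l.appLeft_pull

end Constraints

/-! ### Descent of properties of tensor structures on morphisms -/

section Descent

variable {𝒮 : Type u} [Category.{v} 𝒮] {H₁ : FiberedCat.{v', u'} 𝒮} {H₂ : FiberedCat.{v'', u''} 𝒮}
  {R : Mor H₁ H₂} {t₁ : TensorStr H₁} {t₂ : TensorStr H₂}

/-- Associativity descends along an essentially surjective inverse image. -/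
theorem MorTensor.associative_of_pull (ρ : MorTensor R t₁ t₂) (a₁ : AssocConstraint t₁)
    (a₂ : AssocConstraint t₂) {T X : 𝒮} (f : T ⟶ X) (hf : (H₁.pull f).EssSurj)
    (h : ∀ A B C : H₁.Fib X,
      t₂.tensL (ρ.ρ A B).hom ((R.R X).obj C) ≫ (ρ.ρ (t₁.tens A B) C).hom ≫
          (R.R X).map (a₁.a A B C).hom =
        (a₂.a ((R.R X).obj A) ((R.R X).obj B) ((R.R X).obj C)).hom ≫
          t₂.tensR ((R.R X).obj A) (ρ.ρ B C).hom ≫ (ρ.ρ A (t₁.tens B C)).hom)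
    (A B C : H₁.Fib T) :
    t₂.tensL (ρ.ρ A B).hom ((R.R T).obj C) ≫ (ρ.ρ (t₁.tens A B) C).hom ≫
        (R.R T).map (a₁.a A B C).hom =
      (a₂.a ((R.R T).obj A) ((R.R T).obj B) ((R.R T).obj C)).hom ≫
        t₂.tensR ((R.R T).obj A) (ρ.ρ B C).hom ≫ (ρ.ρ A (t₁.tens B C)).hom := by
  obtain ⟨A', ⟨e₁⟩⟩ := hf.mem_essImage A
  obtain ⟨B', ⟨e₂⟩⟩ := hf.mem_essImage B
  obtain ⟨C', ⟨e₃⟩⟩ := hf.mem_essImage C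
  -- Naturality of `ρ`, `a₁` and `a₂` in each variable in turn reduces to pulled-back objects.
  rw [← cancel_epi (t₂.tensL (t₂.tensL ((R.R T).map e₁.hom) _) _), ← reassoc_of% t₂.tensL_comp,
    ρ.natural_left, reassoc_of% t₂.tensL_comp, reassoc_of% ρ.natural_left, ← Functor.map_comp,
    a₁.natural₁, Functor.map_comp, reassoc_of% a₂.natural₁, reassoc_of% t₂.tensL_tensR,
    ρ.natural_left, ← Category.assoc, ← Category.assoc, ← Category.assoc, ← Category.assoc,
    cancel_mono, Category.assoc, Category.assoc]
  rw [← cancel_epi (t₂.tensL (t₂.tensR _ ((R.R T).map e₂.hom)) _), ← reassoc_of% t₂.tensL_comp,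
    ρ.natural_right, reassoc_of% t₂.tensL_comp, reassoc_of% ρ.natural_left, ← Functor.map_comp,
    a₁.natural₂, Functor.map_comp, reassoc_of% a₂.natural₂, ← reassoc_of% t₂.tensR_comp,
    ρ.natural_left, reassoc_of% t₂.tensR_comp, ρ.natural_right, ← Category.assoc, ← Category.assoc,
    ← Category.assoc, ← Category.assoc, cancel_mono, Category.assoc, Category.assoc]
  rw [← cancel_epi (t₂.tensR _ ((R.R T).map e₃.hom)), ← reassoc_of% t₂.tensL_tensR,
    reassoc_of% ρ.natural_right, ← Functor.map_comp,
    a₁.natural₃, Functor.map_comp, reassoc_of% a₂.natural₃, ← reassoc_of% t₂.tensR_comp,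
    ρ.natural_right, reassoc_of% t₂.tensR_comp, ρ.natural_right, ← Category.assoc, ← Category.assoc,
    ← Category.assoc, ← Category.assoc, cancel_mono, Category.assoc, Category.assoc]
  have p₁ := congrArg (R.R T).map (a₁.pull_comm f A' B' C')
  have h' := congrArg (H₂.pull f).map (h A' B' C')
  have q₁ := congrArg (fun x => t₂.tensL x ((H₂.pull f).obj ((R.R X).obj C')))
    (ρ.pull_comm_pullIso f A' B')
  have q₂ := congrArg (fun x => t₂.tensR ((R.R T).obj ((H₁.pull f).obj A')) x)
    (ρ.pull_comm_pullIso f B' C')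
  simp only [t₂.tensL_comp, t₂.tensR_comp, Functor.map_comp] at p₁ h' q₁ q₂
  -- Prefixing `θ` on the three factors and appending `R` of the comparisons `m` makes `f^*` of the
  -- hypothesis applicable.
  rw [← cancel_epi (t₂.tensL (t₂.tensL (R.pullIso f A').hom _) _ ≫
    t₂.tensL (t₂.tensR _ (R.pullIso f B').hom) _ ≫ t₂.tensR _ (R.pullIso f C').hom),
    ← cancel_mono ((R.R T).map (t₁.tensR _ (t₁.m f B' C').hom) ≫
      (R.R T).map (t₁.m f A' (t₁.tens B' C')).hom)]
  simp only [Category.assoc]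
  rw [← p₁, ← reassoc_of% ρ.natural_left, ← reassoc_of% t₂.tensL_tensR,
    ← reassoc_of% t₂.tensL_tensR,
    ← reassoc_of% q₁, ← reassoc_of% ρ.pull_comm_pullIso, ← R.pullIso_naturality,
    reassoc_of% t₂.tensL_m,
    reassoc_of% h', reassoc_of% a₂.pull_comm, ← reassoc_of% t₂.tensR_m, ρ.pull_comm_pullIso,
    reassoc_of% a₂.natural₃, reassoc_of% a₂.natural₂, reassoc_of% a₂.natural₁,
    ← reassoc_of% ρ.natural_right, ← reassoc_of% q₂, ← reassoc_of% t₂.tensL_tensR,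
    ← reassoc_of% t₂.tensL_tensR]

/-- Symmetry descends along an essentially surjective inverse image. -/
theorem MorTensor.symmetric_of_pull (ρ : MorTensor R t₁ t₂) (c₁ : CommConstraint t₁)
    (c₂ : CommConstraint t₂) {T X : 𝒮} (f : T ⟶ X) (hf : (H₁.pull f).EssSurj)
    (h : ∀ A B : H₁.Fib X, (ρ.ρ A B).hom ≫ (R.R X).map (c₁.c A B).hom =
      (c₂.c ((R.R X).obj A) ((R.R X).obj B)).hom ≫ (ρ.ρ B A).hom) (A B : H₁.Fib T) :
    (ρ.ρ A B).hom ≫ (R.R T).map (c₁.c A B).hom =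
      (c₂.c ((R.R T).obj A) ((R.R T).obj B)).hom ≫ (ρ.ρ B A).hom := by
  obtain ⟨A', ⟨e₁⟩⟩ := hf.mem_essImage A
  obtain ⟨B', ⟨e₂⟩⟩ := hf.mem_essImage B
  rw [← cancel_epi (t₂.tensL ((R.R T).map e₁.hom) _), reassoc_of% ρ.natural_left,
    ← Functor.map_comp, c₁.natural_left, Functor.map_comp, reassoc_of% c₂.natural_left,
    ρ.natural_right, ← Category.assoc, ← Category.assoc, cancel_mono]
  rw [← cancel_epi (t₂.tensR _ ((R.R T).map e₂.hom)), reassoc_of% ρ.natural_right,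
    ← Functor.map_comp, c₁.natural_right, Functor.map_comp, reassoc_of% c₂.natural_right,
    ρ.natural_left, ← Category.assoc, ← Category.assoc, cancel_mono]
  have p₁ := congrArg (R.R T).map (c₁.pull_comm f A' B')
  have h' := congrArg (H₂.pull f).map (h A' B')
  simp only [Functor.map_comp] at p₁ h'
  rw [← cancel_epi (t₂.tensL (R.pullIso f A').hom _ ≫ t₂.tensR _ (R.pullIso f B').hom),
    ← cancel_mono ((R.R T).map (t₁.m f B' A').hom)]
  simp only [Category.assoc]
  rw [← p₁, ← reassoc_of% ρ.pull_comm_pullIso, ← R.pullIso_naturality, reassoc_of% h',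
    reassoc_of% c₂.pull_comm, ρ.pull_comm_pullIso, reassoc_of% c₂.natural_right,
    reassoc_of% c₂.natural_left, ← reassoc_of% t₂.tensL_tensR]

/-! ### Unitarity -/

section Unit

variable {one₁ : Sect H₁} {one₂ : Sect H₂}

/-- Right unitarity descends along an essentially surjective inverse image. -/
theorem MorTensor.unitary_right_of_pull (ρ : MorTensor R t₁ t₂) (e₁ : UnitConstraint t₁ one₁)
    (e₂ : UnitConstraint t₂ one₂) (w : ∀ X, (R.R X).obj (one₁.obj X) ⟶ one₂.obj X) {T X : 𝒮}
    (f : T ⟶ X) (hf : (H₁.pull f).EssSurj)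
    (hw : (H₂.pull f).map (w X) ≫ (one₂.iso f).hom =
      (R.pullIso f (one₁.obj X)).hom ≫ (R.R T).map (one₁.iso f).hom ≫ w T)
    (h : ∀ A : H₁.Fib X, t₂.tensR ((R.R X).obj A) (w X) ≫ (e₂.r ((R.R X).obj A)).hom =
      (ρ.ρ A (one₁.obj X)).hom ≫ (R.R X).map (e₁.r A).hom) (A : H₁.Fib T) :
    t₂.tensR ((R.R T).obj A) (w T) ≫ (e₂.r ((R.R T).obj A)).hom =
      (ρ.ρ A (one₁.obj T)).hom ≫ (R.R T).map (e₁.r A).hom := by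
  obtain ⟨A', ⟨i⟩⟩ := hf.mem_essImage A
  rw [← cancel_epi (t₂.tensL ((R.R T).map i.hom) _), reassoc_of% t₂.tensL_tensR, e₂.r_natural,
    reassoc_of% ρ.natural_left, ← Functor.map_comp, e₁.r_natural, Functor.map_comp,
    ← Category.assoc, ← Category.assoc, cancel_mono]
  have q := congrArg (fun x => t₂.tensR ((R.R T).obj ((H₁.pull f).obj A')) x) hw
  have p₁ := congrArg (R.R T).map (e₁.pull_r f A')
  have h' := congrArg (H₂.pull f).map (h A')
  simp only [Functor.map_comp, t₂.tensR_comp] at p₁ h' q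
  -- Besides `θ`, the structure map of `R(1₁)` at `f` is inserted, so that `hw` exchanges `w T` for
  -- `f^*` of `w X`.
  rw [← cancel_epi (t₂.tensL (R.pullIso f A').hom _ ≫ t₂.tensR _ (R.pullIso f (one₁.obj X)).hom ≫
    t₂.tensR _ ((R.R T).map (one₁.iso f).hom))]
  simp only [Category.assoc]
  rw [reassoc_of% ρ.natural_right, p₁, ← reassoc_of% ρ.pull_comm_pullIso, ← R.pullIso_naturality,
    ← reassoc_of% h', ← reassoc_of% t₂.tensR_m, ← reassoc_of% e₂.pull_r, ← e₂.r_natural,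
    ← reassoc_of% t₂.tensL_tensR, ← reassoc_of% t₂.tensL_tensR, reassoc_of% q]

/-- Left unitarity descends along an essentially surjective inverse image. -/
theorem MorTensor.unitary_left_of_pull (ρ : MorTensor R t₁ t₂) (e₁ : UnitConstraint t₁ one₁)
    (e₂ : UnitConstraint t₂ one₂) (w : ∀ X, (R.R X).obj (one₁.obj X) ⟶ one₂.obj X) {T X : 𝒮}
    (f : T ⟶ X) (hf : (H₁.pull f).EssSurj)
    (hw : (H₂.pull f).map (w X) ≫ (one₂.iso f).hom =
      (R.pullIso f (one₁.obj X)).hom ≫ (R.R T).map (one₁.iso f).hom ≫ w T)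
    (h : ∀ A : H₁.Fib X, t₂.tensL (w X) ((R.R X).obj A) ≫ (e₂.l ((R.R X).obj A)).hom =
      (ρ.ρ (one₁.obj X) A).hom ≫ (R.R X).map (e₁.l A).hom) (A : H₁.Fib T) :
    t₂.tensL (w T) ((R.R T).obj A) ≫ (e₂.l ((R.R T).obj A)).hom =
      (ρ.ρ (one₁.obj T) A).hom ≫ (R.R T).map (e₁.l A).hom := by
  obtain ⟨A', ⟨i⟩⟩ := hf.mem_essImage A
  rw [← cancel_epi (t₂.tensR _ ((R.R T).map i.hom)), ← reassoc_of% t₂.tensL_tensR, e₂.l_natural,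
    reassoc_of% ρ.natural_right, ← Functor.map_comp, e₁.l_natural, Functor.map_comp,
    ← Category.assoc, ← Category.assoc, cancel_mono]
  have q := congrArg (fun x => t₂.tensL x ((R.R T).obj ((H₁.pull f).obj A'))) hw
  have p₁ := congrArg (R.R T).map (e₁.pull_l f A')
  have h' := congrArg (H₂.pull f).map (h A')
  simp only [Functor.map_comp, t₂.tensL_comp] at p₁ h' q
  rw [← cancel_epi (t₂.tensL (R.pullIso f (one₁.obj X)).hom _ ≫ t₂.tensR _ (R.pullIso f A').hom ≫
    t₂.tensL ((R.R T).map (one₁.iso f).hom) _)]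
  simp only [Category.assoc]
  rw [reassoc_of% ρ.natural_left, p₁, ← reassoc_of% ρ.pull_comm_pullIso,
    ← R.pullIso_naturality,
    ← reassoc_of% h', ← reassoc_of% t₂.tensL_m, ← reassoc_of% e₂.pull_l, ← e₂.l_natural,
    reassoc_of% t₂.tensL_tensR, reassoc_of% t₂.tensL_tensR, reassoc_of% t₂.tensL_tensR,
    reassoc_of% q]

end Unit

/-! ### Shifts -/

section Shift

section

variable {C D : Type*} [Category* C] [Category* D] [HasShift C ℤ] [HasShift D ℤ]

/-- `F(A⟦n⟧) ≅ F(A)⟦n⟧` -/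
def shiftApp (F : C ⥤ D) [F.CommShift ℤ] (A : C) (n : ℤ) : F.obj (A⟦n⟧) ≅ (F.obj A)⟦n⟧ :=
  (F.commShiftIso n).app A

lemma shiftApp_naturality (F : C ⥤ D) [F.CommShift ℤ] {A B : C} (x : A ⟶ B) (n : ℤ) :
    F.map (x⟦n⟧') ≫ (shiftApp F B n).hom = (shiftApp F A n).hom ≫ (F.map x)⟦n⟧' :=
  F.commShiftIso_hom_naturality x n

end

variable [H₁.Triangulated] [H₂.Triangulated] [R.Triangulated] [t₁.Triangulated]
  [t₂.Triangulated]

section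

variable (t₁)

lemma TensorStr.tensL_shiftL {X : 𝒮} {A A' : H₁.Fib X} (x : A ⟶ A') (B : H₁.Fib X) (n : ℤ) :
    t₁.tensL (x⟦n⟧') B ≫ shiftL (t₁.tensor X) A' B n =
      shiftL (t₁.tensor X) A B n ≫ (t₁.tensL x B)⟦n⟧' :=
  (((t₁.tensor X).flip.obj B).commShiftIso n).hom.naturality x

/-- Naturality in the unshifted variable is part of the shift structure of the bifunctor: the
transformation induced by `y` commutes with shifts. -/
lemma TensorStr.tensR_shiftL {X : 𝒮} (A : H₁.Fib X) {B B' : H₁.Fib X} (y : B ⟶ B') (n : ℤ) :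
    t₁.tensR (A⟦n⟧) y ≫ shiftL (t₁.tensor X) A B' n =
      shiftL (t₁.tensor X) A B n ≫ (t₁.tensR A y)⟦n⟧' :=
  (NatTrans.shift_app_comm ((t₁.tensor X).flip.map y) n A).symm

lemma TensorStr.tensR_shiftR {X : 𝒮} (A : H₁.Fib X) {B B' : H₁.Fib X} (y : B ⟶ B') (n : ℤ) :
    t₁.tensR A (y⟦n⟧') ≫ shiftR (t₁.tensor X) A B' n =
      shiftR (t₁.tensor X) A B n ≫ (t₁.tensR A y)⟦n⟧' :=
  (((t₁.tensor X).obj A).commShiftIso n).hom.naturality y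

lemma TensorStr.tensL_shiftR {X : 𝒮} {A A' : H₁.Fib X} (x : A ⟶ A') (B : H₁.Fib X) (n : ℤ) :
    t₁.tensL x (B⟦n⟧) ≫ shiftR (t₁.tensor X) A' B n =
      shiftR (t₁.tensor X) A B n ≫ (t₁.tensL x B)⟦n⟧' :=
  (NatTrans.shift_app_comm ((t₁.tensor X).map x) n B).symm

lemma TensorStr.m_shiftL {T X : 𝒮} (f : T ⟶ X) (A B : H₁.Fib X) (n : ℤ) :
    (t₁.m f (A⟦n⟧) B).hom ≫ (H₁.pull f).map (shiftL (t₁.tensor X) A B n) ≫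
        (shiftApp (H₁.pull f) (t₁.tens A B) n).hom =
      t₁.tensL (shiftApp (H₁.pull f) A n).hom ((H₁.pull f).obj B) ≫
        shiftL (t₁.tensor T) ((H₁.pull f).obj A) ((H₁.pull f).obj B) n ≫
        (t₁.m f A B).hom⟦n⟧' :=
  TensorStr.Triangulated.m_shift_left f A B n

lemma TensorStr.m_shiftR {T X : 𝒮} (f : T ⟶ X) (A B : H₁.Fib X) (n : ℤ) :
    (t₁.m f A (B⟦n⟧)).hom ≫ (H₁.pull f).map (shiftR (t₁.tensor X) A B n) ≫
        (shiftApp (H₁.pull f) (t₁.tens A B) n).hom =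
      t₁.tensR ((H₁.pull f).obj A) (shiftApp (H₁.pull f) B n).hom ≫
        shiftR (t₁.tensor T) ((H₁.pull f).obj A) ((H₁.pull f).obj B) n ≫
        (t₁.m f A B).hom⟦n⟧' :=
  TensorStr.Triangulated.m_shift_right f A B n

end

variable (R) in
-- Compatibility of `θ` with shifts, with the shift isomorphisms of the two composite functors
-- written out.
lemma Mor.pullIso_shift {T X : 𝒮} (f : T ⟶ X) (A : H₁.Fib X) (n : ℤ) :
    (H₂.pull f).map ((shiftApp (R.R X) A n).hom) ≫
        (shiftApp (H₂.pull f) ((R.R X).obj A) n).hom ≫ (R.pullIso f A).hom⟦n⟧' =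
      (R.pullIso f (A⟦n⟧)).hom ≫ (R.R T).map ((shiftApp (H₁.pull f) A n).hom) ≫
        (shiftApp (R.R T) ((H₁.pull f).obj A) n).hom := by
  have := Mor.Triangulated.θ_shift (R := R) f
  have h := NatTrans.shift_app_comm (R.θ f).hom n A
  rw [Functor.commShiftIso_comp_hom_app, Functor.commShiftIso_comp_hom_app,
    Category.assoc] at h
  exact h

/-- Compatibility with shifts of the first variable descends along an essentially surjective
inverse image. -/
theorem MorTensor.shift_left_of_pull (ρ : MorTensor R t₁ t₂) {T X : 𝒮} (f : T ⟶ X)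
    (hf : (H₁.pull f).EssSurj) (n : ℤ)
    (h : ∀ A B : H₁.Fib X, (ρ.ρ (A⟦n⟧) B).hom ≫ (R.R X).map (shiftL (t₁.tensor X) A B n) ≫
        (shiftApp (R.R X) (t₁.tens A B) n).hom =
      t₂.tensL ((shiftApp (R.R X) A n).hom) ((R.R X).obj B) ≫
        shiftL (t₂.tensor X) ((R.R X).obj A) ((R.R X).obj B) n ≫ (ρ.ρ A B).hom⟦n⟧')
    (A B : H₁.Fib T) :
    (ρ.ρ (A⟦n⟧) B).hom ≫ (R.R T).map (shiftL (t₁.tensor T) A B n) ≫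
        (shiftApp (R.R T) (t₁.tens A B) n).hom =
      t₂.tensL ((shiftApp (R.R T) A n).hom) ((R.R T).obj B) ≫
        shiftL (t₂.tensor T) ((R.R T).obj A) ((R.R T).obj B) n ≫ (ρ.ρ A B).hom⟦n⟧' := by
  obtain ⟨A', ⟨e₁⟩⟩ := hf.mem_essImage A
  obtain ⟨B', ⟨e₂⟩⟩ := hf.mem_essImage B
  rw [← cancel_epi (t₂.tensL ((R.R T).map (e₁.hom⟦n⟧')) _), reassoc_of% ρ.natural_left,
    ← Functor.map_comp_assoc, t₁.tensL_shiftL, Functor.map_comp_assoc,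
    shiftApp_naturality, ← reassoc_of% t₂.tensL_comp,
    shiftApp_naturality, reassoc_of% t₂.tensL_comp, reassoc_of% t₂.tensL_shiftL,
    ← Functor.map_comp, ρ.natural_left, Functor.map_comp, ← Category.assoc, ← Category.assoc,
    ← Category.assoc, ← Category.assoc, cancel_mono, Category.assoc, Category.assoc]
  rw [← cancel_epi (t₂.tensR _ ((R.R T).map e₂.hom)), reassoc_of% ρ.natural_right,
    ← Functor.map_comp_assoc, t₁.tensR_shiftL, Functor.map_comp_assoc,
    shiftApp_naturality, ← reassoc_of% t₂.tensL_tensR, reassoc_of% t₂.tensR_shiftL,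
    ← Functor.map_comp, ρ.natural_right, Functor.map_comp, ← Category.assoc, ← Category.assoc,
    ← Category.assoc, ← Category.assoc, cancel_mono, Category.assoc, Category.assoc]
  have p₁ := congrArg (R.R T).map (t₁.m_shiftL f A' B' n)
  have h' := congrArg (H₂.pull f).map (h A' B')
  have q := congrArg (shiftFunctor (H₂.Fib T) n).map (ρ.pull_comm_pullIso f A' B')
  have s := congrArg (fun x => t₂.tensL x ((H₂.pull f).obj ((R.R X).obj B')))
    (R.pullIso_shift f A' n)
  simp only [Functor.map_comp, t₂.tensL_comp] at p₁ h' q s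
  -- The hypothesis over `X` concerns `f^*` of `A'⟦n⟧`, the goal the shift of `f^* A'`; the shift
  -- isomorphism of `f^*` bridges the two.
  rw [← cancel_epi (t₂.tensL ((R.R T).map ((shiftApp (H₁.pull f) A' n).hom)) _),
    reassoc_of% ρ.natural_left,
    ← cancel_epi (t₂.tensL (R.pullIso f (A'⟦n⟧)).hom _ ≫ t₂.tensR _ (R.pullIso f B').hom),
    ← cancel_mono (((R.R T).map (t₁.m f A' B').hom)⟦n⟧')]
  simp only [Category.assoc]
  rw [← shiftApp_naturality, ← reassoc_of% p₁, ← reassoc_of% ρ.pull_comm_pullIso,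
    ← reassoc_of% R.pullIso_naturality, ← R.pullIso_shift, reassoc_of% h', ← reassoc_of% t₂.tensL_m,
    reassoc_of% shiftApp_naturality,
    reassoc_of% t₂.m_shiftL, q, ← reassoc_of% t₂.tensL_shiftL,
    ← reassoc_of% t₂.tensR_shiftL, reassoc_of% s, reassoc_of% t₂.tensL_tensR,
    reassoc_of% t₂.tensL_tensR,
    reassoc_of% t₂.tensL_tensR]

/-- Compatibility with shifts of the second variable descends along an essentially surjective
inverse image. -/
theorem MorTensor.shift_right_of_pull (ρ : MorTensor R t₁ t₂) {T X : 𝒮} (f : T ⟶ X)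
    (hf : (H₁.pull f).EssSurj) (n : ℤ)
    (h : ∀ A B : H₁.Fib X, (ρ.ρ A (B⟦n⟧)).hom ≫ (R.R X).map (shiftR (t₁.tensor X) A B n) ≫
        (shiftApp (R.R X) (t₁.tens A B) n).hom =
      t₂.tensR ((R.R X).obj A) ((shiftApp (R.R X) B n).hom) ≫
        shiftR (t₂.tensor X) ((R.R X).obj A) ((R.R X).obj B) n ≫ (ρ.ρ A B).hom⟦n⟧')
    (A B : H₁.Fib T) :
    (ρ.ρ A (B⟦n⟧)).hom ≫ (R.R T).map (shiftR (t₁.tensor T) A B n) ≫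
        (shiftApp (R.R T) (t₁.tens A B) n).hom =
      t₂.tensR ((R.R T).obj A) ((shiftApp (R.R T) B n).hom) ≫
        shiftR (t₂.tensor T) ((R.R T).obj A) ((R.R T).obj B) n ≫ (ρ.ρ A B).hom⟦n⟧' := by
  obtain ⟨A', ⟨e₁⟩⟩ := hf.mem_essImage A
  obtain ⟨B', ⟨e₂⟩⟩ := hf.mem_essImage B
  rw [← cancel_epi (t₂.tensL ((R.R T).map e₁.hom) _), reassoc_of% ρ.natural_left,
    ← Functor.map_comp_assoc, t₁.tensL_shiftR, Functor.map_comp_assoc,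
    shiftApp_naturality, reassoc_of% t₂.tensL_tensR, reassoc_of% t₂.tensL_shiftR,
    ← Functor.map_comp, ρ.natural_left, Functor.map_comp, ← Category.assoc, ← Category.assoc,
    ← Category.assoc, ← Category.assoc, cancel_mono, Category.assoc, Category.assoc]
  rw [← cancel_epi (t₂.tensR _ ((R.R T).map (e₂.hom⟦n⟧'))), reassoc_of% ρ.natural_right,
    ← Functor.map_comp_assoc, t₁.tensR_shiftR, Functor.map_comp_assoc,
    shiftApp_naturality, ← reassoc_of% t₂.tensR_comp,
    shiftApp_naturality, reassoc_of% t₂.tensR_comp, reassoc_of% t₂.tensR_shiftR,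
    ← Functor.map_comp, ρ.natural_right, Functor.map_comp, ← Category.assoc, ← Category.assoc,
    ← Category.assoc, ← Category.assoc, cancel_mono, Category.assoc, Category.assoc]
  have p₁ := congrArg (R.R T).map (t₁.m_shiftR f A' B' n)
  have h' := congrArg (H₂.pull f).map (h A' B')
  have q := congrArg (shiftFunctor (H₂.Fib T) n).map (ρ.pull_comm_pullIso f A' B')
  have s := congrArg (fun x => t₂.tensR ((R.R T).obj ((H₁.pull f).obj A')) x)
    (R.pullIso_shift f B' n)
  simp only [Functor.map_comp, t₂.tensR_comp] at p₁ h' q s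
  -- As for the first variable, replace the shift of `f^* B'` by `f^*` of `B'⟦n⟧`.
  rw [← cancel_epi (t₂.tensR _ ((R.R T).map ((shiftApp (H₁.pull f) B' n).hom))),
    reassoc_of% ρ.natural_right,
    ← cancel_epi (t₂.tensL (R.pullIso f A').hom _ ≫ t₂.tensR _ (R.pullIso f (B'⟦n⟧)).hom),
    ← cancel_mono (((R.R T).map (t₁.m f A' B').hom)⟦n⟧')]
  simp only [Category.assoc]
  rw [← shiftApp_naturality, ← reassoc_of% p₁, ← reassoc_of% ρ.pull_comm_pullIso,
    ← reassoc_of% R.pullIso_naturality, ← R.pullIso_shift, reassoc_of% h', ← reassoc_of% t₂.tensR_m,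
    reassoc_of% shiftApp_naturality,
    reassoc_of% t₂.m_shiftR, q, ← reassoc_of% t₂.tensL_shiftR,
    ← reassoc_of% t₂.tensR_shiftR, ← reassoc_of% s, reassoc_of% t₂.tensL_tensR,
    reassoc_of% t₂.tensL_tensR,
    reassoc_of% t₂.tensL_tensR, reassoc_of% t₂.tensL_tensR]

end Shift

end Descent

/-! ### Sections are determined by their value on a final object -/

section Sections

variable {𝒮 : Type u} [Category.{v} 𝒮] {H : FiberedCat.{v', u'} 𝒮}

lemma FiberedCat.conn_inv_assoc {T X V W : 𝒮} (f : T ⟶ X) (g : X ⟶ V) (h : V ⟶ W)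
    (fg : T ⟶ V) (gh : X ⟶ W) (k : T ⟶ W) (hfg : f ≫ g = fg) (hgh : g ≫ h = gh)
    (h₁ : f ≫ gh = k) (h₂ : fg ≫ h = k) (A : H.Fib W) :
    (H.pull f).map ((H.conn g h gh hgh).inv.app A) ≫ (H.conn f gh k h₁).inv.app A =
      (H.conn f g fg hfg).inv.app ((H.pull h).obj A) ≫ (H.conn fg h k h₂).inv.app A := by
  have e := H.conn_assoc f g h fg gh k hfg hgh h₁ h₂ A
  have e' : (H.conn f gh k h₁).app A ≪≫ (H.pull f).mapIso ((H.conn g h gh hgh).app A) =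
      (H.conn fg h k h₂).app A ≪≫ (H.conn f g fg hfg).app ((H.pull h).obj A) := Iso.ext e
  exact congrArg Iso.inv e'

lemma Sect.map_iso_comp (A : Sect H) {V T X : 𝒮} (f : V ⟶ T) (g : T ⟶ X) (h : V ⟶ X)
    (w : f ≫ g = h) :
    (H.pull f).map (A.iso g).hom ≫ (A.iso f).hom =
      (H.conn f g h w).inv.app (A.obj X) ≫ (A.iso h).hom := by
  subst w
  exact A.comp f g

/-- A section built from its value `A₀` on a final object `E`. -/
def Sect.ofFinal {E : 𝒮} (π : ∀ X, X ⟶ E) (hπ : ∀ {T X : 𝒮} (f : T ⟶ X), f ≫ π X = π T)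
    (A₀ : H.Fib E) (D : ∀ X, Σ A : H.Fib X, (H.pull (π X)).obj A₀ ≅ A) : Sect H where
  obj X := (D X).1
  iso {T X} f := (H.pull f).mapIso (D X).2.symm ≪≫ ((H.conn f (π X) (π T) (hπ f)).app A₀).symm ≪≫
    (D T).2
  comp {V T X} f g := by
    have h := H.conn_inv_assoc f g (π X) (f ≫ g) (π T) (π V) rfl (hπ g) (hπ f) (hπ _) A₀
    have h' := (H.conn f g (f ≫ g) rfl).inv.naturality (D X).2.inv
    simp only [Functor.comp_map, Functor.comp_obj] at h h'
    simp only [Iso.trans_hom, Functor.mapIso_hom, Iso.symm_hom, Iso.app_inv, Functor.map_comp,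
      Category.assoc]
    rw [← Functor.map_comp_assoc (H.pull f) (D T).2.hom, Iso.hom_inv_id,
      CategoryTheory.Functor.map_id, Category.id_comp, reassoc_of% h, reassoc_of% h']

/-- The structure maps along the `π X` force all others, by the composition rule for `f ≫ π X = π
T`. -/
lemma Sect.ofFinal_self {E : 𝒮} (π : ∀ X, X ⟶ E) (hπ : ∀ {T X : 𝒮} (f : T ⟶ X), f ≫ π X = π T)
    (A : Sect H) : Sect.ofFinal π hπ (A.obj E) (fun X => ⟨A.obj X, A.iso (π X)⟩) = A := by
  refine Sect.ext rfl (heq_of_eq ?_)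
  funext T X f
  ext1
  have h := A.map_iso_comp f (π X) (π T) (hπ f)
  simp only [Sect.ofFinal, Iso.trans_hom, Functor.mapIso_hom, Iso.symm_hom, Iso.app_inv]
  rw [← h, ← Functor.map_comp_assoc, Iso.inv_hom_id]
  simp

/-- An isomorphism of sections built from its value on a final object. -/
def SectIso.ofFinal {E : 𝒮} (π : ∀ X, X ⟶ E) (hπ : ∀ {T X : 𝒮} (f : T ⟶ X), f ≫ π X = π T)
    {A B : Sect H} (e : A.obj E ≅ B.obj E) : SectIso A B where
  iso X := (A.iso (π X)).symm ≪≫ (H.pull (π X)).mapIso e ≪≫ B.iso (π X)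
  comm {T X} f := by
    have hA := A.map_iso_comp f (π X) (π T) (hπ f)
    have hB := B.map_iso_comp f (π X) (π T) (hπ f)
    have h := (H.conn f (π X) (π T) (hπ f)).inv.naturality e.hom
    simp only [Functor.comp_map, Functor.comp_obj] at h
    simp only [Iso.trans_hom, Functor.mapIso_hom, Iso.symm_hom, Functor.map_comp, Category.assoc]
    rw [hB, reassoc_of% h, ← cancel_epi ((H.pull f).map (A.iso (π X)).hom), reassoc_of% hA,
      Iso.hom_inv_id_assoc, ← Functor.map_comp_assoc, Iso.hom_inv_id,
      CategoryTheory.Functor.map_id, Category.id_comp]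

lemma SectIso.iso_hom_eq {A B : Sect H} (e : SectIso A B) {X E : 𝒮} (f : X ⟶ E) :
    (e.iso X).hom = (A.iso f).inv ≫ (H.pull f).map (e.iso E).hom ≫ (B.iso f).hom := by
  rw [e.comm, Iso.inv_hom_id_assoc]

variable [HasFiniteProducts 𝒮] [HasInitial 𝒮] (G : Geometry 𝒮)

/-- No embedding is needed: the final object lies in `𝒰`, and its fiber carries all the information.
-/
theorem Sect.restrict_surjective (A : Sect (H.restrict G.U)) :
    ∃ A' : Sect H, A'.restrict G.U = A := by
  classical
  let E : G.U.FullSubcategory := ⟨⊤_ 𝒮, G.U_terminal⟩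
  let π : ∀ X : G.U.FullSubcategory, X ⟶ E := fun X => ObjectProperty.homMk (terminal.from X.obj)
  have hπ : ∀ {T X : G.U.FullSubcategory} (f : T ⟶ X), f ≫ π X = π T := fun f =>
    InducedCategory.hom_ext (Subsingleton.elim _ _)
  -- Keeping the given objects over `𝒰`, and using the pullback from `*` only elsewhere, makes the
  -- restriction equal to `A` and not merely isomorphic to it.
  let D : ∀ X : 𝒮, Σ B : H.Fib X, (H.pull (terminal.from X)).obj (A.obj E) ≅ B := fun X =>
    if h : G.U X then ⟨A.obj ⟨X, h⟩, A.iso (π ⟨X, h⟩)⟩ else ⟨_, Iso.refl _⟩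
  refine ⟨Sect.ofFinal (E := ⊤_ 𝒮) (fun X => terminal.from X) (fun f => Subsingleton.elim _ _)
    (A.obj E) D, ?_⟩
  change Sect.ofFinal (H := H.restrict G.U) (E := E) π hπ (A.obj E) (fun X => D X.obj) = A
  have hD : (fun X : G.U.FullSubcategory => D X.obj) = fun X => ⟨A.obj X, A.iso (π X)⟩ := by
    funext X
    exact dif_pos X.property
  exact (congrArg (Sect.ofFinal (H := H.restrict G.U) (E := E) π hπ (A.obj E)) hD).trans
    (Sect.ofFinal_self π hπ A)

theorem SectIso.existsUnique_restrict_eq {A B : Sect H}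
    (e : SectIso (A.restrict G.U) (B.restrict G.U)) : ∃! e' : SectIso A B, e'.restrict G.U = e := by
  refine ⟨SectIso.ofFinal (fun X => terminal.from X) (fun f => Subsingleton.elim _ _)
    (e.iso ⟨⊤_ 𝒮, G.U_terminal⟩), ?_, ?_⟩
  · refine SectIso.ext (funext fun X => Iso.ext ?_)
    exact (e.iso_hom_eq (E := ⟨⊤_ 𝒮, G.U_terminal⟩)
      (ObjectProperty.homMk (terminal.from X.obj))).symm
  · rintro e' rfl
    exact SectIso.ext (funext fun X => Iso.ext (e'.iso_hom_eq (terminal.from X)))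

end Sections

/-! ### Extension of tensor structures and constraints -/

section Existence

variable {𝒮 : Type u} [Category.{v} 𝒮] [HasFiniteProducts 𝒮] [HasInitial 𝒮] {G : Geometry 𝒮}
  {H : FiberedCat.{v', u'} 𝒮} {t : TensorStr H}

/-- Extension on the threefold product `H.prod (H.prod H)`; the pentagon at `T` comes from an
embedding of `T` into an object of `𝒰`. -/
theorem AssocConstraint.existsUnique_restrict_eq
    (hH : ∀ {Z X : 𝒮} (z : Z ⟶ X), G.cl z → IsReflection (H.pull z))
    (a : AssocConstraint (t.restrict G.U)) :
    ∃! a' : AssocConstraint t, a'.restrict G.U = a := by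
  have hK : ∀ {Z X : 𝒮} (z : Z ⟶ X), G.cl z →
      IsReflection ((H.prod (H.prod H)).pull z) :=
    fun z hz => (hH z hz).prod ((hH z hz).prod (hH z hz))
  obtain ⟨τ, hτ⟩ := PseudoIso.restrict_surjective G (F := t.tensor₃Left) (F' := t.tensor₃Right)
    hK a.toPseudoIso
  refine ⟨AssocConstraint.ofPseudoIso τ (fun {T} => ?_), ?_, fun a' ha' => ?_⟩
  · obtain ⟨P, z, hP, hz⟩ := G.exists_embedding T
    exact ⟨P, z, a.a (X := ⟨P, hP⟩), (hH z hz).essSurj,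
      fun A B C => (congrArg (fun σ => (σ.iso ⟨P, hP⟩).app (A, B, C)) hτ).symm,
      a.pentagon (X := ⟨P, hP⟩)⟩
  -- The natural isomorphism attached to the restricted new constraint is, by definition, the
  -- restriction of `τ`.
  · exact AssocConstraint.toPseudoIso_injective hτ
  · refine AssocConstraint.toPseudoIso_injective (PseudoIso.restrict_injective G hK ?_)
    exact (congrArg AssocConstraint.toPseudoIso ha').trans hτ.symm

theorem CommConstraint.existsUnique_restrict_eq
    (hH : ∀ {Z X : 𝒮} (z : Z ⟶ X), G.cl z → IsReflection (H.pull z))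
    (c : CommConstraint (t.restrict G.U)) :
    ∃! c' : CommConstraint t, c'.restrict G.U = c := by
  have hK : ∀ {Z X : 𝒮} (z : Z ⟶ X), G.cl z → IsReflection ((H.prod H).pull z) :=
    fun z hz => (hH z hz).prod (hH z hz)
  obtain ⟨τ, hτ⟩ := PseudoIso.restrict_surjective G (F := PseudoMor.tensor t)
    (F' := (PseudoMor.swap H H).trans (PseudoMor.tensor t)) hK c.toPseudoIso
  refine ⟨CommConstraint.ofPseudoIso τ (fun {T} => ?_), ?_, fun c' hc' => ?_⟩
  · obtain ⟨P, z, hP, hz⟩ := G.exists_embedding T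
    exact ⟨P, z, c.c (X := ⟨P, hP⟩), (hH z hz).essSurj,
      fun A B => (congrArg (fun σ => (σ.iso ⟨P, hP⟩).app (A, B)) hτ).symm,
      c.symm (X := ⟨P, hP⟩)⟩
  · exact CommConstraint.toPseudoIso_injective hτ
  · refine CommConstraint.toPseudoIso_injective (PseudoIso.restrict_injective G hK ?_)
    exact (congrArg CommConstraint.toPseudoIso hc').trans hτ.symm

theorem UnitConstraint.existsUnique_restrict_eq
    (hH : ∀ {Z X : 𝒮} (z : Z ⟶ X), G.cl z → IsReflection (H.pull z)) {one : Sect H}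
    (e : UnitConstraint (t.restrict G.U) (one.restrict G.U)) :
    ∃! e' : UnitConstraint t one, e'.restrict G.U = e := by
  obtain ⟨ρ, hρ⟩ := PseudoIso.restrict_surjective G (F := t.tensorOne one)
    (F' := PseudoMor.id H) hH e.rightPseudoIso
  obtain ⟨l, hl⟩ := PseudoIso.restrict_surjective G (F := t.oneTensor one)
    (F' := PseudoMor.id H) hH e.leftPseudoIso
  refine ⟨UnitConstraint.ofPseudoIso ρ l (fun {T} => ?_), ?_, fun e' he' => ?_⟩
  · obtain ⟨P, z, hP, hz⟩ := G.exists_embedding T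
    refine ⟨P, z, ?_⟩
    have hr := congrArg (fun σ => ((σ.iso ⟨P, hP⟩).app (one.obj P)).hom) hρ
    have hl' := congrArg (fun σ => ((σ.iso ⟨P, hP⟩).app (one.obj P)).hom) hl
    exact hr.trans ((e.r_one_eq_l_one ⟨P, hP⟩).trans hl'.symm)
  · exact UnitConstraint.eq_of_pseudoIso hρ hl
  · refine UnitConstraint.eq_of_pseudoIso (PseudoIso.restrict_injective G hH ?_)
      (PseudoIso.restrict_injective G hH ?_)
    · exact (congrArg UnitConstraint.rightPseudoIso he').trans hρ.symm
    · exact (congrArg UnitConstraint.leftPseudoIso he').trans hl.symm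

variable {H₁ : FiberedCat.{v', u'} 𝒮} {H₂ : FiberedCat.{v'', u''} 𝒮} {R : Mor H₁ H₂}
  {t₁ : TensorStr H₁} {t₂ : TensorStr H₂}

/-- A tensor structure on a morphism is exactly a natural isomorphism on `H₁.prod H₁` commuting with
inverse images, so no further axiom has to descend. -/
theorem MorTensor.existsUnique_restrict_eq
    (hH : ∀ {Z X : 𝒮} (z : Z ⟶ X), G.cl z → IsReflection (H₁.pull z))
    (ρ : MorTensor (R.restrict G.U) (t₁.restrict G.U) (t₂.restrict G.U)) :
    ∃! ρ' : MorTensor R t₁ t₂, ρ'.restrict G.U = ρ := by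
  have hK : ∀ {Z X : 𝒮} (z : Z ⟶ X), G.cl z → IsReflection ((H₁.prod H₁).pull z) :=
    fun z hz => (hH z hz).prod (hH z hz)
  obtain ⟨τ, hτ⟩ := PseudoIso.restrict_surjective G (F := MorTensor.source R t₂)
    (F' := MorTensor.target R t₁) hK ρ.toPseudoIso
  refine ⟨MorTensor.ofPseudoIso τ, ?_, fun ρ' hρ' => ?_⟩
  · exact MorTensor.toPseudoIso_injective hτ
  · refine MorTensor.toPseudoIso_injective (PseudoIso.restrict_injective G hK ?_)
    exact (congrArg MorTensor.toPseudoIso hρ').trans hτ.symm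

theorem MorTensor.isTriangulated_of_restrict
    (hH : ∀ {Z X : 𝒮} (z : Z ⟶ X), G.cl z → IsReflection (H₁.pull z))
    (ρ : MorTensor R t₁ t₂) [H₁.Triangulated] [H₂.Triangulated]
    [R.Triangulated] [t₁.Triangulated] [t₂.Triangulated]
    (h : (ρ.restrict G.U).IsTriangulated) : ρ.IsTriangulated where
  shift_left {X} A B n := by
    obtain ⟨P, z, hP, hz⟩ := G.exists_embedding X
    exact ρ.shift_left_of_pull z (hH z hz).essSurj n
      (fun A B => h.shift_left (X := ⟨P, hP⟩) A B n) A B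
  shift_right {X} A B n := by
    obtain ⟨P, z, hP, hz⟩ := G.exists_embedding X
    exact ρ.shift_right_of_pull z (hH z hz).essSurj n
      (fun A B => h.shift_right (X := ⟨P, hP⟩) A B n) A B

theorem MorTensor.isAssociative_of_restrict
    (hH : ∀ {Z X : 𝒮} (z : Z ⟶ X), G.cl z → IsReflection (H₁.pull z))
    (ρ : MorTensor R t₁ t₂) (a₁ : AssocConstraint t₁) (a₂ : AssocConstraint t₂)
    (h : (ρ.restrict G.U).IsAssociative (a₁.restrict G.U) (a₂.restrict G.U)) :
    ρ.IsAssociative a₁ a₂ := by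
  intro X A B C
  obtain ⟨P, z, hP, hz⟩ := G.exists_embedding X
  exact ρ.associative_of_pull a₁ a₂ z (hH z hz).essSurj (h (X := ⟨P, hP⟩)) A B C

theorem MorTensor.isSymmetric_of_restrict
    (hH : ∀ {Z X : 𝒮} (z : Z ⟶ X), G.cl z → IsReflection (H₁.pull z))
    (ρ : MorTensor R t₁ t₂) (c₁ : CommConstraint t₁) (c₂ : CommConstraint t₂)
    (h : (ρ.restrict G.U).IsSymmetric (c₁.restrict G.U) (c₂.restrict G.U)) :
    ρ.IsSymmetric c₁ c₂ := by
  intro X A B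
  obtain ⟨P, z, hP, hz⟩ := G.exists_embedding X
  exact ρ.symmetric_of_pull c₁ c₂ z (hH z hz).essSurj (h (X := ⟨P, hP⟩)) A B

theorem MorTensor.isUnitary_of_restrict
    (hH : ∀ {Z X : 𝒮} (z : Z ⟶ X), G.cl z → IsReflection (H₁.pull z))
    (ρ : MorTensor R t₁ t₂) {one₁ : Sect H₁} {one₂ : Sect H₂}
    (e₁ : UnitConstraint t₁ one₁) (e₂ : UnitConstraint t₂ one₂)
    (w : SectIso (R.sect one₁) one₂)
    (h : (ρ.restrict G.U).IsUnitary (e₁.restrict G.U) (e₂.restrict G.U) (w.restrict G.U)) :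
    ρ.IsUnitary e₁ e₂ w := by
  constructor
  · intro X A
    obtain ⟨P, z, hP, hz⟩ := G.exists_embedding X
    exact ρ.unitary_right_of_pull e₁ e₂ (fun X => (w.iso X).hom) z (hH z hz).essSurj
      ((w.comm z).trans (Category.assoc _ _ _)) (h.1 (X := ⟨P, hP⟩)) A
  · intro X A
    obtain ⟨P, z, hP, hz⟩ := G.exists_embedding X
    exact ρ.unitary_left_of_pull e₁ e₂ (fun X => (w.iso X).hom) z (hH z hz).essSurj
      ((w.comm z).trans (Category.assoc _ _ _)) (h.2 (X := ⟨P, hP⟩)) A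

end Existence

end FibExt

/-! ### Assembly of the theorem -/

theorem lemma4 {𝒮 : Type u} [Category.{v} 𝒮] [HasFiniteProducts 𝒮]
    [HasInitial 𝒮] (G : Geometry 𝒮)
    -- two localic fibered categories
    (H₁ : FiberedCat.{v', u'} 𝒮) [H₁.Triangulated] (hH₁ : H₁.IsLocalic G)
    (H₂ : FiberedCat.{v'', u''} 𝒮) [H₂.Triangulated] (hH₂ : H₂.IsLocalic G)
    -- endowed with localic internal tensor structures
    (t₁ : TensorStr H₁) [t₁.Triangulated] (ht₁ : t₁.IsLocalic G)
    (t₂ : TensorStr H₂) [t₂.Triangulated] (ht₂ : t₂.IsLocalic G)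
    -- a localic morphism
    (R : Mor H₁ H₂) [R.Triangulated] (hR : R.IsLocalic G)
    -- a triangulated internal tensor structure on its restriction to `𝒰`
    (ρ : MorTensor (R.restrict G.U) (t₁.restrict G.U) (t₂.restrict G.U))
    (hρ : ρ.IsTriangulated) :
    -- the extension `ρ'` of `ρ` to `𝒮`
    (∃! ρ' : MorTensor R t₁ t₂, ρ'.IsTriangulated ∧ ρ'.restrict G.U = ρ) ∧
    ∀ ρ' : MorTensor R t₁ t₂, ρ'.IsTriangulated → ρ'.restrict G.U = ρ →
      -- associativity, with respect to the extended constraints `a₁'`, `a₂'`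
      (∀ (a₁ : AssocConstraint (t₁.restrict G.U)) (a₂ : AssocConstraint (t₂.restrict G.U)),
        (∃! a₁' : AssocConstraint t₁, a₁'.restrict G.U = a₁) ∧
        (∃! a₂' : AssocConstraint t₂, a₂'.restrict G.U = a₂) ∧
        (ρ.IsAssociative a₁ a₂ →
          ∀ (a₁' : AssocConstraint t₁) (a₂' : AssocConstraint t₂),
            a₁'.restrict G.U = a₁ → a₂'.restrict G.U = a₂ → ρ'.IsAssociative a₁' a₂')) ∧
      -- symmetry, with respect to the extended constraints `c₁'`, `c₂'`
      (∀ (c₁ : CommConstraint (t₁.restrict G.U)) (c₂ : CommConstraint (t₂.restrict G.U)),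
        (∃! c₁' : CommConstraint t₁, c₁'.restrict G.U = c₁) ∧
        (∃! c₂' : CommConstraint t₂, c₂'.restrict G.U = c₂) ∧
        (ρ.IsSymmetric c₁ c₂ →
          ∀ (c₁' : CommConstraint t₁) (c₂' : CommConstraint t₂),
            c₁'.restrict G.U = c₁ → c₂'.restrict G.U = c₂ → ρ'.IsSymmetric c₁' c₂')) ∧
      -- unitarity: sections over `𝒰` extend to `𝒮`, uniquely up to unique isomorphism extending
      -- the identity, so the unit sections over `𝒰` are written as restrictions of their
      -- extensions `one₁`, `one₂`
      (∀ one : Sect (H₁.restrict G.U), ∃ one' : Sect H₁, one'.restrict G.U = one) ∧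
      (∀ one : Sect (H₂.restrict G.U), ∃ one' : Sect H₂, one'.restrict G.U = one) ∧
      (∀ (A B : Sect H₁) (e : SectIso (A.restrict G.U) (B.restrict G.U)),
        ∃! e' : SectIso A B, e'.restrict G.U = e) ∧
      (∀ (A B : Sect H₂) (e : SectIso (A.restrict G.U) (B.restrict G.U)),
        ∃! e' : SectIso A B, e'.restrict G.U = e) ∧
      (∀ (one₁ : Sect H₁) (one₂ : Sect H₂)
        (e₁ : UnitConstraint (t₁.restrict G.U) (one₁.restrict G.U))
        (e₂ : UnitConstraint (t₂.restrict G.U) (one₂.restrict G.U))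
        (w : SectIso ((R.restrict G.U).sect (one₁.restrict G.U)) (one₂.restrict G.U)),
        (∃! e₁' : UnitConstraint t₁ one₁, e₁'.restrict G.U = e₁) ∧
        (∃! e₂' : UnitConstraint t₂ one₂, e₂'.restrict G.U = e₂) ∧
        (∃! w' : SectIso (R.sect one₁) one₂, w'.restrict G.U = w) ∧
        (ρ.IsUnitary e₁ e₂ w →
          ∀ (e₁' : UnitConstraint t₁ one₁) (e₂' : UnitConstraint t₂ one₂)
            (w' : SectIso (R.sect one₁) one₂),
            e₁'.restrict G.U = e₁ → e₂'.restrict G.U = e₂ → w'.restrict G.U = w →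
            ρ'.IsUnitary e₁' e₂' w')) := by
  have h₁ : ∀ {Z X : 𝒮} (z : Z ⟶ X), G.cl z → IsReflection (H₁.pull z) := hH₁.direct_image
  have h₂ : ∀ {Z X : 𝒮} (z : Z ⟶ X), G.cl z → IsReflection (H₂.pull z) := hH₂.direct_image
  refine ⟨?_, ?_⟩
  · obtain ⟨ρ', rfl, hu⟩ := MorTensor.existsUnique_restrict_eq (t₁ := t₁) (t₂ := t₂) h₁ ρ
    -- Uniqueness already holds among all extensions; compatibility of the extension with shifts is
    -- inherited from `𝒰`.
    exact ⟨ρ', ⟨MorTensor.isTriangulated_of_restrict h₁ ρ' hρ, rfl⟩, fun σ hσ => hu σ hσ.2⟩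
  · rintro ρ' - rfl
    refine ⟨fun a₁ a₂ => ⟨a₁.existsUnique_restrict_eq h₁, a₂.existsUnique_restrict_eq h₂, ?_⟩,
      fun c₁ c₂ => ⟨c₁.existsUnique_restrict_eq h₁, c₂.existsUnique_restrict_eq h₂, ?_⟩,
      Sect.restrict_surjective G, Sect.restrict_surjective G,
      fun _ _ => SectIso.existsUnique_restrict_eq G,
      fun _ _ => SectIso.existsUnique_restrict_eq G,
      fun one₁ one₂ e₁ e₂ w => ⟨e₁.existsUnique_restrict_eq h₁, e₂.existsUnique_restrict_eq h₂,
        -- Forming `R(1)` commutes with restriction by definition, so `w` is an isomorphism between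
        -- restrictions of sections over `𝒮`.
        SectIso.existsUnique_restrict_eq G (A := R.sect one₁) w, ?_⟩⟩
    · rintro h a₁' a₂' rfl rfl
      exact MorTensor.isAssociative_of_restrict h₁ ρ' a₁' a₂' h
    · rintro h c₁' c₂' rfl rfl
      exact MorTensor.isSymmetric_of_restrict h₁ ρ' c₁' c₂' h
    · rintro h e₁' e₂' w' rfl rfl rfl
      exact MorTensor.isUnitary_of_restrict h₁ ρ' e₁' e₂' w' h
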